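/- For $s\in\mathbb{R}$ let $H^s(\mathbb{R}^n)$ be the space of tempered distributions $u$ with $\|u\|_{H^s}^2=\int_{\mathbb{R}^n}(1+|\xi|^2)^s|\hat u(\xi)|^2\,d\xi<\infty$. For an open set $\Omega\subset\mathbb{R}^n$ let $\widetilde H^s(\Omega)$ be the closure in $H^s(\mathbb{R}^n)$ of the set of smooth functions with compact support contained in $\Omega$, and let $H^s_{\overline\Omega}$ be the set of all $u\in H^s(\mathbb{R}^n)$ with $\operatorname{supp}u\subset\overline\Omega$. We say that $\Omega$ is $C^0$ at $x\in\partial\Omega$ if there are orthogonal coordinates $y=(y',y_n)\in\mathbb{R}^{n-1}\times\mathbb{R}$, numbers $a_1,\dots,a_n>0$ with $x\in V:=\{|y_j|<a_j,\ 1\le j\le n\}$, and a continuous function $f$ on $V':=\{|y_j|<a_j,\ 1\le j\le n-1\}$ with $|f|\le a_n/2$, such that $\Omega\cap V=\{y\in V: y_n<f(y')\}$ and $\partial\Omega\cap V=\{y\in V: y_n=f(y')\}$. The set $\Omega$ is $C^0$ if it is $C^0$ at every $x\in\partial\Omega$, and it is $C^0$ except at $P\subset\partial\Omega$ if it is $C^0$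 at every $x\in\partial\Omega\setminus P$. We call $P\subset\partial\Omega$ exceptional for $\Omega$ if $P$ is closed and countable and has at most finitely many limit points in every bounded subset of $\partial\Omega$. **Theorem.** Let $|s|\le 1$ if $n\ge 2$, and $|s|\le 1/2$ if $n=1$. 1. If $\Omega\subset\mathbb{R}^n$ is open and is $C^0$ except at a set $P$ that is exceptional for $\Omega$, then $\widetilde H^s(\Omega)=H^s_{\overline\Omega}$. 2. In particular, let $\Omega=\bigcup_i\Omega_i$ be a union of pairwise disjoint $C^0$ open sets, and let $P$ be exceptional for $\Omega$, such that $\overline{\Omega_i}\cap\overline{\Omega_j}\subset P$ for all $i\ne j$, and such that every $x\in\partial\Omega\setminus P$ has a neighbourhood that meets only finitely many of the $\Omega_i$ (this holds automatically for a finite union). Then $\widetilde H^s(\Omega)=H^s_{\overline\Omega}$. -/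

import Mathlib

open MeasureTheory Filter Topology
open scoped SchwartzMap

noncomputable section

/-! ### The Sobolev spaces `H^s(ℝⁿ)` and their subspaces -/

/-- The linear space underlying `H^s(ℝⁿ) = {u ∈ 𝓢'(ℝⁿ) : J_s u ∈ L²(ℝⁿ)}`, where `J_s` is the Bessel
potential operator, i.e. the Fourier multiplier with symbol `(1 + |ξ|²)^(s/2)`.
Mathlib's Fourier transform has the kernel `exp(-2πi x·ξ)`. With the kernel `exp(-i x·ξ)` one gets
the same space with an equivalent norm, hence the same closed subspaces. -/
def sobolevSubmodule (n : ℕ) (s : ℝ) :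
    Submodule ℂ 𝓢'(EuclideanSpace ℝ (Fin n), ℂ) where
  carrier := {u | TemperedDistribution.MemSobolev s 2 u}
  add_mem' hu hv := hu.add hv
  zero_mem' := TemperedDistribution.memSobolev_fun_zero _ _ s 2
  smul_mem' c _ hu := hu.smul c

/-- The Sobolev space `H^s(ℝⁿ)` as a type of its own: it carries the norm `‖u‖ = ‖J_s u‖_{L²}` defined
below, and not the topology of `𝓢'(ℝⁿ)`. -/
def SobolevH (n : ℕ) (s : ℝ) : Type := sobolevSubmodule n s

instance (n : ℕ) (s : ℝ) : AddCommGroup (SobolevH n s) :=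
  inferInstanceAs (AddCommGroup (sobolevSubmodule n s))

instance (n : ℕ) (s : ℝ) : Module ℂ (SobolevH n s) :=
  inferInstanceAs (Module ℂ (sobolevSubmodule n s))

namespace SobolevH

variable {n : ℕ} {s : ℝ}

/-- The tempered distribution underlying an element of `H^s(ℝⁿ)`. -/
def toDistr : SobolevH n s →ₗ[ℂ] 𝓢'(EuclideanSpace ℝ (Fin n), ℂ) :=
  (sobolevSubmodule n s).subtype

theorem toDistr_injective : Function.Injective (toDistr (n := n) (s := s)) :=
  Subtype.val_injective

theorem memSobolev (u : SobolevH n s) : TemperedDistribution.MemSobolev s 2 (toDistr u) :=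
  u.2

/-- An `L²` function is determined by the tempered distribution it defines. -/
theorem eq_of_coe_eq {f g : Lp ℂ 2 (volume : Measure (EuclideanSpace ℝ (Fin n)))}
    (h : (f : 𝓢'(EuclideanSpace ℝ (Fin n), ℂ)) = (g : 𝓢'(EuclideanSpace ℝ (Fin n), ℂ))) :
    f = g :=
  LinearMap.ker_eq_bot.1 (Lp.ker_toTemperedDistributionCLM_eq_bot (F := ℂ)
    (μ := (volume : Measure (EuclideanSpace ℝ (Fin n)))) (p := 2)) h

/-- The function `J_s u ∈ L²(ℝⁿ)`, for `u ∈ H^s(ℝⁿ)`. -/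
def besselFun (u : SobolevH n s) : Lp ℂ 2 (volume : Measure (EuclideanSpace ℝ (Fin n))) :=
  (memSobolev u).choose

theorem besselFun_spec (u : SobolevH n s) :
    TemperedDistribution.besselPotential (EuclideanSpace ℝ (Fin n)) ℂ s (toDistr u) =
      (besselFun u : 𝓢'(EuclideanSpace ℝ (Fin n), ℂ)) :=
  (memSobolev u).choose_spec

/-- The operator `J_s : H^s(ℝⁿ) → L²(ℝⁿ)` as a linear map. -/
def toL2 : SobolevH n s →ₗ[ℂ] Lp ℂ 2 (volume : Measure (EuclideanSpace ℝ (Fin n))) where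
  toFun := besselFun
  map_add' u v := by
    apply eq_of_coe_eq
    have h := fun w : SobolevH n s => besselFun_spec w
    simp only [← Lp.toTemperedDistributionCLM_apply] at h ⊢
    rw [map_add, ← h, ← h, ← h, map_add, map_add]
  map_smul' c u := by
    apply eq_of_coe_eq
    have h := fun w : SobolevH n s => besselFun_spec w
    simp only [← Lp.toTemperedDistributionCLM_apply] at h ⊢
    rw [map_smul, ← h, ← h, map_smul, map_smul, RingHom.id_apply]

theorem toL2_spec (u : SobolevH n s) :
    TemperedDistribution.besselPotential (EuclideanSpace ℝ (Fin n)) ℂ s (toDistr u) =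
      (toL2 u : 𝓢'(EuclideanSpace ℝ (Fin n), ℂ)) :=
  besselFun_spec u

theorem toL2_injective : Function.Injective (toL2 (n := n) (s := s)) := by
  intro u v h
  apply toDistr_injective
  have h1 := toL2_spec u
  rw [h, ← toL2_spec v] at h1
  have h2 := congrArg
    (TemperedDistribution.besselPotential (EuclideanSpace ℝ (Fin n)) ℂ (-s)) h1
  simpa using h2

/-- The norm `‖u‖_{H^s} = ‖J_s u‖_{L²}` of `H^s(ℝⁿ)`. -/
instance : NormedAddCommGroup (SobolevH n s) :=
  NormedAddCommGroup.induced (SobolevH n s) _ toL2 toL2_injective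

instance : NormedSpace ℂ (SobolevH n s) :=
  NormedSpace.induced ℂ (SobolevH n s) _ toL2

theorem norm_eq (u : SobolevH n s) : ‖u‖ = ‖toL2 u‖ := rfl

/-- A Schwartz function, as an element of `H^s(ℝⁿ)`. -/
def ofSchwartz (s : ℝ) (φ : 𝓢(EuclideanSpace ℝ (Fin n), ℂ)) : SobolevH n s :=
  ⟨(φ : 𝓢'(EuclideanSpace ℝ (Fin n), ℂ)), φ.memSobolev⟩

end SobolevH

/-- `𝓓(Ω)`, the smooth functions with compact support contained in `Ω`, inside `H^s(ℝⁿ)`. -/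
def testFunctions {n : ℕ} (s : ℝ) (Ω : Set (EuclideanSpace ℝ (Fin n))) : Set (SobolevH n s) :=
  {u | ∃ φ : 𝓢(EuclideanSpace ℝ (Fin n), ℂ),
    HasCompactSupport φ ∧ tsupport φ ⊆ Ω ∧ u = SobolevH.ofSchwartz s φ}

/-- `H̃^s(Ω)`, the closure of `𝓓(Ω)` in `H^s(ℝⁿ)`. -/
def sobolevTilde {n : ℕ} (s : ℝ) (Ω : Set (EuclideanSpace ℝ (Fin n))) : Set (SobolevH n s) :=
  closure (testFunctions s Ω)

/-- `H^s_F`, the set of all `u ∈ H^s(ℝⁿ)` whose distributional support is contained in `F`. -/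
def sobolevSupported {n : ℕ} (s : ℝ) (F : Set (EuclideanSpace ℝ (Fin n))) :
    Set (SobolevH n s) :=
  {u | Distribution.dsupport (SobolevH.toDistr u) ⊆ F}

/-! ### Open sets with continuous boundary -/

/-- Near `x`, the set `Ω` is the strict hypograph, and its boundary is the graph, of a continuous
function: there are new orthogonal coordinates `y = (y', t) ∈ ℝⁿ⁻¹ × ℝ` (given by the isometry `e`)
and a box `V = {|y'ⱼ| < aⱼ for all j, |t| < b}` containing `x`, and a continuous function `f` on
`V' = {|y'ⱼ| < aⱼ for all j}` with `|f| ≤ b / 2`, such that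
`Ω ∩ V = {y ∈ V : t < f y'}` and `∂Ω ∩ V = {y ∈ V : t = f y'}`. -/
def IsC0At {n : ℕ} (Ω : Set (EuclideanSpace ℝ (Fin n))) (x : EuclideanSpace ℝ (Fin n)) : Prop :=
  ∃ (e : EuclideanSpace ℝ (Fin n) ≃ᵃⁱ[ℝ] WithLp 2 (EuclideanSpace ℝ (Fin (n - 1)) × ℝ))
    (a : Fin (n - 1) → ℝ) (b : ℝ) (f : EuclideanSpace ℝ (Fin (n - 1)) → ℝ),
    (∀ j, |(e x).fst j| < a j) ∧ |(e x).snd| < b ∧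
    ContinuousOn f {y | ∀ j, |y j| < a j} ∧
    (∀ y, (∀ j, |y j| < a j) → |f y| ≤ b / 2) ∧
    ∀ z, (∀ j, |(e z).fst j| < a j) → |(e z).snd| < b →
      (z ∈ Ω ↔ (e z).snd < f (e z).fst) ∧ (z ∈ frontier Ω ↔ (e z).snd = f (e z).fst)

/-- `Ω` is `C⁰` except at the points of `P`. -/
def IsC0Except {n : ℕ} (Ω P : Set (EuclideanSpace ℝ (Fin n))) : Prop :=
  ∀ x ∈ frontier Ω \ P, IsC0At Ω x

/-- `Ω` is `C⁰`. -/
def IsC0 {n : ℕ} (Ω : Set (EuclideanSpace ℝ (Fin n))) : Prop :=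
  ∀ x ∈ frontier Ω, IsC0At Ω x

/-- `P ⊆ ∂Ω` is closed and countable, with at most finitely many limit points in every bounded
subset of `∂Ω`. -/
structure IsExceptionalSet {n : ℕ} (Ω P : Set (EuclideanSpace ℝ (Fin n))) : Prop where
  subset_frontier : P ⊆ frontier Ω
  isClosed : IsClosed P
  countable : P.Countable
  finite_limit_points : ∀ B ⊆ frontier Ω, Bornology.IsBounded B → (B ∩ derivedSet P).Finite

end

/-!
# Equality of `H̃^s(Ω)` and `H^s` with support in the closure, for `|s| ≤ 1`

The inclusion of `H̃^s(Ω)` in the distributions supported in `closure Ω` holds since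
`u ↦ u φ` is continuous on `H^s` for each test function `φ`. For the converse, the map
`u ↦ J_s u` identifies `H^s` with `L²`, so it suffices that `∫ (J_s u) b = 0` whenever `b ∈ L²` and the
distribution `J_s b ∈ H^{-s}` vanishes on `Ω` (`mem_sobolevTilde_of_integral_eq_zero`). This pairing is
symmetric in `u` and `J_s b`, one of which has nonnegative order and hence is a function. For `s ≥ 0`
this is a function supported in `F = closure Ω`, paired with a distribution that vanishes on `G = Ω`; for
`s < 0` it is a function supported in `F = Ωᶜ`, paired with a distribution that vanishes on
`G = (closure Ω)ᶜ`. Both cases are covered by `OrthogonalTo.of_exceptional`, for a function of order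
`0 ≤ s ≤ 1`.

* Near a point where the boundary is continuous, translation against the last adapted coordinate moves
  `closure Ω` into `Ω`, and translation along it moves `Ωᶜ` into `(closure Ω)ᶜ`
  (`IsC0At.canPush`, `CanPush.compl`). A function with support in a compact subset of `F` without
  exceptional points is cut by a partition of unity, its pieces are translated into `G`, and there it is
  approximated by test functions (`OrthogonalTo.of_canPush`).
* A bounded function in `H^s` remains bounded in `H^s` when it is multiplied by cutoff functions that
  vanish on smaller and smaller balls around a point, as `2 s ≤ n` and `s ≤ 1`. Weak convergence then
  removes the point (`exists_sobolevEnergy_pointCutoff_mul_le`, `OrthogonalTo.of_finite_inter`). In a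
  compact set without limit points of `P` there are only finitely many points of `P`, and in any
  compact set only finitely many limit points; so `P` is removed in two steps.
* Truncation of the values and of the support reduces the general case to bounded functions with
  compact support (`OrthogonalTo.of_truncate`, `OrthogonalTo.of_bounded_support`).

The estimates for products, cutoffs and truncations rest on a description of the `H^s` norm,
`0 ≤ s ≤ 1`, by `L²` norms of differences with dyadic steps along the coordinate axes
(`exists_sobolevEnergy_le`). It behaves well under pointwise operations: the differences
of the new function are bounded by those of the old one and an explicit remainder.

For a union of sets `Ωᵢ`, the union coincides with one of the `Ωᵢ` near each boundary point outside of
`P` (`canPush_sUnion`), and only this local information enters.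
-/

open scoped ENNReal FourierTransform

/-! ### Dyadic sums -/

/-- The quantity `∑ₖ 4^(ks) dₖ` for `s < 1`, and `supₖ 4^(ks) dₖ` for `s ≥ 1`. Applied to the squared
`L²` norms `dₖ` of the differences of `f` with step `2⁻ᵏ`, it is the square of the homogeneous part
of the norm of `H^s` when `0 < s ≤ 1` (a Besov-type description; at `s = 1` the sum would diverge and
the supremum takes its place). -/
noncomputable def dyadicSum (s : ℝ) (d : ℕ → ℝ≥0∞) : ℝ≥0∞ :=
  if s < 1 then ∑' k, ENNReal.ofReal (((4 : ℝ) ^ k) ^ s) * d k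
  else ⨆ k, ENNReal.ofReal (((4 : ℝ) ^ k) ^ s) * d k

theorem dyadicSum_mono {s : ℝ} {d d' : ℕ → ℝ≥0∞} (h : ∀ k, d k ≤ d' k) :
    dyadicSum s d ≤ dyadicSum s d' := by
  unfold dyadicSum
  split_ifs
  · exact ENNReal.tsum_le_tsum fun k => by gcongr; exact h k
  · exact iSup_mono fun k => by gcongr; exact h k

theorem dyadicSum_add_le (s : ℝ) (d d' : ℕ → ℝ≥0∞) :
    dyadicSum s (fun k => d k + d' k) ≤ dyadicSum s d + dyadicSum s d' := by
  unfold dyadicSum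
  split_ifs
  · simp only [mul_add]
    rw [ENNReal.tsum_add]
  · refine iSup_le fun k => ?_
    rw [mul_add]
    exact add_le_add (le_iSup (fun k => ENNReal.ofReal (((4 : ℝ) ^ k) ^ s) * d k) k)
      (le_iSup (fun k => ENNReal.ofReal (((4 : ℝ) ^ k) ^ s) * d' k) k)

theorem dyadicSum_const_mul (s : ℝ) (c : ℝ≥0∞) (d : ℕ → ℝ≥0∞) :
    dyadicSum s (fun k => c * d k) = c * dyadicSum s d := by
  unfold dyadicSum
  split_ifs
  · rw [← ENNReal.tsum_mul_left]
    exact tsum_congr fun k => by ring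
  · rw [ENNReal.mul_iSup]
    exact iSup_congr fun k => by ring

theorem dyadicSum_le_of_term {s : ℝ} (hs : ¬ s < 1) {d : ℕ → ℝ≥0∞} {C : ℝ≥0∞}
    (h : ∀ k, ENNReal.ofReal (((4 : ℝ) ^ k) ^ s) * d k ≤ C) : dyadicSum s d ≤ C := by
  rw [dyadicSum, if_neg hs]
  exact iSup_le h

theorem le_dyadicSum (s : ℝ) (d : ℕ → ℝ≥0∞) (k : ℕ) :
    ENNReal.ofReal (((4 : ℝ) ^ k) ^ s) * d k ≤ dyadicSum s d := by
  unfold dyadicSum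
  split_ifs
  · exact ENNReal.le_tsum k
  · exact le_iSup (fun k => ENNReal.ofReal (((4 : ℝ) ^ k) ^ s) * d k) k

/-- A two-sided geometric series, with the distance `|k - m|` written as the sum of the two truncated
differences. -/
theorem tsum_geometric_dist_le (r : ℝ≥0∞) (m : ℕ) :
    ∑' k : ℕ, r ^ ((k - m) + (m - k)) ≤ 2 * (1 - r)⁻¹ * (1 + r) := by
  have h2 : ∑' k : ℕ, r ^ ((k - m) + (m - k)) =
      (∑ k ∈ Finset.range m, r ^ ((k - m) + (m - k))) +
        ∑' k : ℕ, r ^ ((k + m - m) + (m - (k + m))) := (ENNReal.summable.sum_add_tsum_nat_add'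
          (k := m) (f := fun k : ℕ => r ^ ((k - m) + (m - k)))).symm
  have h3 : ∑ k ∈ Finset.range m, r ^ ((k - m) + (m - k)) ≤ (1 - r)⁻¹ * r := by
    calc ∑ k ∈ Finset.range m, r ^ ((k - m) + (m - k))
        = ∑ k ∈ Finset.range m, r ^ (m - 1 - k + 1) := by
          refine Finset.sum_congr rfl fun k hk => ?_
          have := Finset.mem_range.1 hk
          congr 1
          omega
      _ = ∑ k ∈ Finset.range m, r ^ (k + 1) :=
          Finset.sum_range_reflect (fun k => r ^ (k + 1)) m
      _ ≤ ∑' k : ℕ, r ^ (k + 1) := ENNReal.sum_le_tsum _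
      _ = (1 - r)⁻¹ * r := by
          simp only [pow_succ]
          rw [ENNReal.tsum_mul_right, ENNReal.tsum_geometric]
  have h4 : ∑' k : ℕ, r ^ ((k + m - m) + (m - (k + m))) = (1 - r)⁻¹ := by
    rw [← ENNReal.tsum_geometric]
    refine tsum_congr fun k => ?_
    congr 1
    omega
  rw [h2, h4]
  calc _ ≤ (1 - r)⁻¹ * r + (1 - r)⁻¹ := by gcongr
    _ = (1 - r)⁻¹ * (1 + r) := by ring
    _ ≤ 2 * (1 - r)⁻¹ * (1 + r) := by
        rw [mul_assoc]
        exact le_mul_of_one_le_left (by positivity) one_le_two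

theorem four_rpow_lt_one {t : ℝ} (ht : t < 0) : (4 : ℝ) ^ t < 1 :=
  Real.rpow_lt_one_of_one_lt_of_neg (by norm_num) ht

/-- Uniformly in `x ≥ 1`, the dyadic sum of `min (1, 4⁻ᵏ x)` is at most a constant times `x ^ s`. -/
theorem exists_dyadicSum_min_le {s : ℝ} (hs0 : 0 < s) (hs1 : s ≤ 1) :
    ∃ C : ℝ≥0∞, C ≠ ∞ ∧ ∀ x : ℝ, 1 ≤ x →
      dyadicSum s (fun k => ENNReal.ofReal (min 1 (x / 4 ^ k))) ≤ C * ENNReal.ofReal (x ^ s) := by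
  rcases hs1.lt_or_eq with hs | rfl
  · set r : ℝ := max ((4 : ℝ) ^ (-s)) ((4 : ℝ) ^ (s - 1)) with hr
    have hr0 : 0 < r := lt_max_of_lt_left (by positivity)
    have hr1 : r < 1 := max_lt (four_rpow_lt_one (by linarith)) (four_rpow_lt_one (by linarith))
    refine ⟨2 * (1 - ENNReal.ofReal r)⁻¹ * (1 + ENNReal.ofReal r) * 4, ?_, fun x hx => ?_⟩
    · have : (1 - ENNReal.ofReal r)⁻¹ ≠ ∞ := by
        rw [ENNReal.inv_ne_top]
        exact (tsub_pos_of_lt (by simpa using hr1)).ne'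
      finiteness
    obtain ⟨m, hm1, hm2⟩ := exists_nat_pow_near hx (by norm_num : (1 : ℝ) < 4)
    have hx0 : 0 < x := by linarith
    have key : ∀ k : ℕ, ENNReal.ofReal (((4 : ℝ) ^ k) ^ s) * ENNReal.ofReal (min 1 (x / 4 ^ k)) ≤
        ENNReal.ofReal r ^ ((k - (m + 1)) + (m + 1 - k)) * ENNReal.ofReal (4 * x ^ s) := by
      intro k
      rw [← ENNReal.ofReal_pow hr0.le, ← ENNReal.ofReal_mul (by positivity),
        ← ENNReal.ofReal_mul (by positivity)]
      apply ENNReal.ofReal_le_ofReal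
      rcases le_or_gt k (m + 1) with hk | hk
      · obtain ⟨j, hj⟩ := Nat.exists_eq_add_of_le hk
        have e : (k - (m + 1)) + (m + 1 - k) = j := by omega
        rw [e]
        have h1 : ((4 : ℝ) ^ k) ^ s = (4 ^ (m + 1)) ^ s * ((4 : ℝ) ^ (-s)) ^ j := by
          rw [hj, pow_add (4 : ℝ) k j, Real.mul_rpow (by positivity) (by positivity), mul_assoc,
            ← Real.rpow_natCast _ j, ← Real.rpow_natCast _ j, ← Real.rpow_mul (by norm_num),
            ← Real.rpow_mul (by norm_num), ← Real.rpow_add (by norm_num)]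
          rw [show (j : ℝ) * s + -s * j = 0 by ring]
          simp
        have h2 : ((4 : ℝ) ^ (m + 1)) ^ s ≤ 4 * x ^ s := by
          rw [pow_succ, mul_comm, Real.mul_rpow (by norm_num) (by positivity)]
          gcongr
          calc (4 : ℝ) ^ s ≤ 4 ^ (1 : ℝ) := by gcongr; norm_num
            _ = 4 := by simp
        calc ((4 : ℝ) ^ k) ^ s * min 1 (x / 4 ^ k) ≤ ((4 : ℝ) ^ k) ^ s * 1 := by
              gcongr; exact min_le_left _ _
          _ = ((4 : ℝ) ^ (-s)) ^ j * (4 ^ (m + 1)) ^ s := by rw [h1]; ring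
          _ ≤ r ^ j * (4 * x ^ s) := by
              gcongr
              exact le_max_left _ _
      · obtain ⟨j, hj⟩ := Nat.exists_eq_add_of_le hk.le
        have e : (k - (m + 1)) + (m + 1 - k) = j := by omega
        rw [e]
        have h1 : ((4 : ℝ) ^ k) ^ s * (x / 4 ^ k) = x * (4 ^ (m + 1)) ^ (s - 1) *
            ((4 : ℝ) ^ (s - 1)) ^ j := by
          have h4 : ((4 : ℝ) ^ k) ^ s * (x / 4 ^ k) = x * ((4 : ℝ) ^ k) ^ (s - 1) := by
            rw [Real.rpow_sub_one (by positivity)]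
            ring
          rw [h4, hj, pow_add (4 : ℝ) (m + 1) j, Real.mul_rpow (by positivity) (by positivity),
            mul_assoc, ← Real.rpow_natCast _ j, ← Real.rpow_natCast _ j,
            ← Real.rpow_mul (by norm_num), ← Real.rpow_mul (by norm_num), mul_comm (j : ℝ)]
        have h2 : x * ((4 : ℝ) ^ (m + 1)) ^ (s - 1) ≤ 4 * x ^ s := by
          calc x * ((4 : ℝ) ^ (m + 1)) ^ (s - 1) ≤ x * x ^ (s - 1) := by
                gcongr ?_ * ?_
                exact Real.rpow_le_rpow_of_nonpos hx0 hm2.le (by linarith)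
            _ = x ^ s := by
                rw [Real.rpow_sub_one hx0.ne']
                field_simp
            _ ≤ 4 * x ^ s := by
                have : 0 ≤ x ^ s := by positivity
                linarith
        calc ((4 : ℝ) ^ k) ^ s * min 1 (x / 4 ^ k) ≤ ((4 : ℝ) ^ k) ^ s * (x / 4 ^ k) := by
              gcongr; exact min_le_right _ _
          _ = ((4 : ℝ) ^ (s - 1)) ^ j * (x * (4 ^ (m + 1)) ^ (s - 1)) := by rw [h1]; ring
          _ ≤ r ^ j * (4 * x ^ s) := by
              gcongr
              exact le_max_right _ _
    rw [dyadicSum, if_pos hs]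
    refine (ENNReal.tsum_le_tsum key).trans ?_
    rw [ENNReal.tsum_mul_right, ENNReal.ofReal_mul (by norm_num), ← mul_assoc]
    gcongr
    · exact tsum_geometric_dist_le _ _
    · simp
  · refine ⟨1, by simp, fun x hx => dyadicSum_le_of_term (by simp) fun k => ?_⟩
    rw [one_mul, ← ENNReal.ofReal_mul (by positivity)]
    apply ENNReal.ofReal_le_ofReal
    rw [Real.rpow_one, Real.rpow_one]
    calc (4 : ℝ) ^ k * min 1 (x / 4 ^ k) ≤ 4 ^ k * (x / 4 ^ k) := by
          gcongr; exact min_le_right _ _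
      _ = x := by field_simp

/-- The dyadic sum of `4⁻ᵏ` is finite for all `s ≤ 1`. -/
theorem dyadicSum_four_inv_pow_ne_top {s : ℝ} (hs1 : s ≤ 1) :
    dyadicSum s (fun k => ENNReal.ofReal (1 / 4 ^ k)) ≠ ∞ := by
  have key : ∀ k : ℕ, ENNReal.ofReal (((4 : ℝ) ^ k) ^ s) * ENNReal.ofReal (1 / 4 ^ k) =
      ENNReal.ofReal ((4 : ℝ) ^ (s - 1)) ^ k := by
    intro k
    rw [← ENNReal.ofReal_mul (by positivity), ← ENNReal.ofReal_pow (by positivity)]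
    congr 1
    calc ((4 : ℝ) ^ k) ^ s * (1 / 4 ^ k) = ((4 : ℝ) ^ k) ^ (s - 1) := by
          rw [Real.rpow_sub_one (by positivity)]
          ring
      _ = _ := by
          rw [← Real.rpow_natCast _ k, ← Real.rpow_natCast _ k, ← Real.rpow_mul (by norm_num),
            ← Real.rpow_mul (by norm_num), mul_comm]
  rcases hs1.lt_or_eq with hs | rfl
  · rw [dyadicSum, if_pos hs]
    simp only [key]
    rw [ENNReal.tsum_geometric, Ne, ENNReal.inv_eq_top, tsub_eq_zero_iff_le, not_le]
    simpa using four_rpow_lt_one (by linarith : s - 1 < 0)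
  · refine ne_top_of_le_ne_top ENNReal.one_ne_top (dyadicSum_le_of_term (by simp) fun k => ?_)
    rw [key]
    simp

/-- The dyadic sums belonging to the dilates by `2ᴶ` of a fixed bump function stay bounded as
`J → ∞`. This expresses that points have zero `H^s` capacity and uses `2 s ≤ n`. -/
theorem exists_dyadicSum_dilate_le {n : ℕ} {s : ℝ}
    (hns : (2 ≤ n ∧ s ≤ 1) ∨ (n = 1 ∧ s ≤ 1 / 2)) :
    ∃ C : ℝ≥0∞, C ≠ ∞ ∧ ∀ J : ℕ,
      dyadicSum s (fun k => ENNReal.ofReal ((1 / 2 ^ J) ^ n * min 1 (4 ^ J / 4 ^ k))) ≤ C := by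
  rcases hns with ⟨hn, hs⟩ | ⟨rfl, hs⟩
  · refine ⟨_, dyadicSum_four_inv_pow_ne_top hs, fun J => dyadicSum_mono fun k => ?_⟩
    apply ENNReal.ofReal_le_ofReal
    calc ((1 : ℝ) / 2 ^ J) ^ n * min 1 (4 ^ J / 4 ^ k)
        ≤ (1 / 2 ^ J) ^ 2 * (4 ^ J / 4 ^ k) := by
          gcongr ?_ * ?_
          · refine pow_le_pow_of_le_one (by positivity) ?_ hn
            rw [div_le_one (by positivity)]
            exact one_le_pow₀ (by norm_num)
          · exact min_le_right _ _
      _ = 1 / 4 ^ k := by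
          rw [show (4 : ℝ) = 2 ^ 2 by norm_num, ← pow_mul, ← pow_mul]
          field_simp
          ring
  · refine ⟨2 * (1 - ENNReal.ofReal (1 / 2))⁻¹ * (1 + ENNReal.ofReal (1 / 2)), ?_, fun J => ?_⟩
    · have : (1 - ENNReal.ofReal (1 / 2))⁻¹ ≠ ∞ := by
        rw [ENNReal.inv_ne_top]
        refine (tsub_pos_of_lt ?_).ne'
        rw [ENNReal.ofReal_lt_one]
        norm_num
      finiteness
    rw [dyadicSum, if_pos (by linarith)]
    refine (ENNReal.tsum_le_tsum fun k => ?_).trans (tsum_geometric_dist_le _ J)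
    rw [← ENNReal.ofReal_mul (by positivity), ← ENNReal.ofReal_pow (by norm_num)]
    apply ENNReal.ofReal_le_ofReal
    have h1 : ((4 : ℝ) ^ k) ^ s ≤ 2 ^ k := by
      calc ((4 : ℝ) ^ k) ^ s ≤ (4 ^ k) ^ (1 / 2 : ℝ) := by
            gcongr
            exact one_le_pow₀ (by norm_num)
        _ = 2 ^ k := by
            rw [show (4 : ℝ) = 2 ^ 2 by norm_num, ← pow_mul, mul_comm, pow_mul,
              ← Real.sqrt_eq_rpow, Real.sqrt_sq (by positivity)]
    rcases le_total k J with hk | hk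
    · obtain ⟨j, rfl⟩ := Nat.exists_eq_add_of_le hk
      have e : (k - (k + j)) + (k + j - k) = j := by omega
      rw [e]
      calc ((4 : ℝ) ^ k) ^ s * ((1 / 2 ^ (k + j)) ^ 1 * min 1 (4 ^ (k + j) / 4 ^ k))
          ≤ 2 ^ k * ((1 / 2 ^ (k + j)) ^ 1 * 1) := by
            gcongr
            exact min_le_left _ _
        _ = (1 / 2) ^ j := by
            simp only [pow_add, one_div_pow]
            field_simp
    · obtain ⟨j, rfl⟩ := Nat.exists_eq_add_of_le hk
      have e : (J + j - J) + (J - (J + j)) = j := by omega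
      rw [e]
      calc ((4 : ℝ) ^ (J + j)) ^ s * ((1 / 2 ^ J) ^ 1 * min 1 (4 ^ J / 4 ^ (J + j)))
          ≤ 2 ^ (J + j) * ((1 / 2 ^ J) ^ 1 * (4 ^ J / 4 ^ (J + j))) := by
            gcongr
            exact min_le_right _ _
        _ = (1 / 2) ^ j := by
            have h2 : ∀ i : ℕ, (4 : ℝ) ^ i = 2 ^ i * 2 ^ i := fun i => by
              rw [← mul_pow]; norm_num
            simp only [h2, pow_add, one_div_pow]
            field_simp

/-! ### Differences and the Fourier transform -/

section Translation

variable {E : Type*} [NormedAddCommGroup E] [InnerProductSpace ℝ E] [FiniteDimensional ℝ E]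
  [MeasurableSpace E] [BorelSpace E]

/-- The translate `x ↦ f (x + h)` of a square integrable function. -/
noncomputable def translateLp (h : E) (f : Lp ℂ 2 (volume : Measure E)) :
    Lp ℂ 2 (volume : Measure E) :=
  Lp.compMeasurePreserving (· + h) (measurePreserving_add_right volume h) f

theorem coeFn_translateLp (h : E) (f : Lp ℂ 2 (volume : Measure E)) :
    translateLp h f =ᵐ[volume] fun x => f (x + h) :=
  Lp.coeFn_compMeasurePreserving f (measurePreserving_add_right volume h)

theorem continuous_translateLp_apply (h : E) : Continuous (translateLp h) :=
  (Lp.isometry_compMeasurePreserving (measurePreserving_add_right volume h)).continuous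

theorem tendsto_translateLp {ι : Type*} {l : Filter ι} {h : ι → E} (hh : Tendsto h l (𝓝 0))
    (f : Lp ℂ 2 (volume : Measure E)) : Tendsto (fun i => translateLp (h i) f) l (𝓝 f) := by
  have h0 : Tendsto (fun i => translateLp (h i) f) l (𝓝 (translateLp 0 f)) := by
    refine Filter.Tendsto.compMeasurePreservingLp (g := fun i => ⟨(· + h i), by fun_prop⟩)
      (g₀ := ⟨(· + 0), by fun_prop⟩) (tendsto_const_nhds (x := f)) ?_
      (fun i => measurePreserving_add_right volume (h i)) (measurePreserving_add_right volume 0)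
      (by simp)
    have hc : Continuous fun v : E => (⟨(· + v), by fun_prop⟩ : C(E, E)) :=
      ContinuousMap.continuous_of_continuous_uncurry _ (by
        simp only [Function.uncurry_def, ContinuousMap.coe_mk]; fun_prop)
    exact (hc.tendsto 0).comp hh
  convert h0
  refine Lp.ext ?_
  filter_upwards [coeFn_translateLp 0 f] with x hx
  simp [hx]

theorem fourier_compSubConstCLM_neg (h : E) (φ : 𝓢(E, ℂ)) (ξ : E) :
    𝓕 (SchwartzMap.compSubConstCLM ℂ (-h) φ) ξ =
      Complex.exp ((2 * Real.pi * inner ℝ h ξ : ℝ) * Complex.I) * 𝓕 φ ξ := by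
  have h6 : (SchwartzMap.compSubConstCLM ℂ (-h) φ : E → ℂ) = φ ∘ fun v => v + h := by
    ext v
    rw [SchwartzMap.compSubConstCLM_apply, sub_neg_eq_add]
    rfl
  rw [SchwartzMap.fourier_coe, SchwartzMap.fourier_coe, h6]
  have h5 := congrFun (VectorFourier.fourierIntegral_comp_add_right Real.fourierChar
    (volume : Measure E) (innerₗ E) φ h) ξ
  rw [Circle.smul_def, Real.fourierChar_apply] at h5
  exact h5

/-- The Fourier transform turns a translation into a multiplication by a character. -/
theorem fourier_translateLp (h : E) (f : Lp ℂ 2 (volume : Measure E)) :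
    ((𝓕 (translateLp h f) : Lp ℂ 2 (volume : Measure E)) : E → ℂ) =ᵐ[volume]
      fun ξ => Complex.exp ((2 * Real.pi * inner ℝ h ξ : ℝ) * Complex.I) *
        (𝓕 f : Lp ℂ 2 (volume : Measure E)) ξ := by
  have hm : MemLp (fun ξ : E => Complex.exp ((2 * Real.pi * inner ℝ h ξ : ℝ) * Complex.I)) ∞
      volume := by
    refine memLp_top_of_bound (Continuous.aestronglyMeasurable ?_) 1
      (ae_of_all _ fun ξ => (Complex.norm_exp_ofReal_mul_I _).le)
    fun_prop
  have key : 𝓕 (translateLp h f) = (hm.toLp _ • (𝓕 f : Lp ℂ 2 (volume : Measure E)) :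
      Lp ℂ 2 (volume : Measure E)) := by
    refine DenseRange.induction_on
      (p := fun f : Lp ℂ 2 (volume : Measure E) =>
        𝓕 (translateLp h f) = (hm.toLp _ • (𝓕 f : Lp ℂ 2 (volume : Measure E)) :
          Lp ℂ 2 (volume : Measure E)))
      (SchwartzMap.denseRange_toLpCLM (p := 2) (F := ℂ) (E := E) (μ := volume)
        ENNReal.ofNat_ne_top) f ?_ ?_
    · refine isClosed_eq ?_ ?_
      · exact (Lp.fourierTransformₗᵢ E ℂ).continuous.comp (continuous_translateLp_apply h)
      · have h1 : Continuous fun g : Lp ℂ 2 (volume : Measure E) =>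
            (hm.toLp _ • g : Lp ℂ 2 (volume : Measure E)) := by
          refine (LipschitzWith.of_dist_le_mul (K := ‖hm.toLp _‖₊) fun g g' => ?_).continuous
          rw [dist_eq_norm, dist_eq_norm, sub_eq_add_neg, sub_eq_add_neg, ← Lp.smul_neg,
            ← Lp.add_smul]
          exact Lp.norm_smul_le _ _
        exact h1.comp (Lp.fourierTransformₗᵢ E ℂ).continuous
    · intro φ
      have h1 : translateLp h (SchwartzMap.toLpCLM ℝ ℂ 2 volume φ) =
          (SchwartzMap.compSubConstCLM ℂ (-h) φ).toLp 2 := by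
        refine Lp.ext ?_
        have h2 : (SchwartzMap.toLpCLM ℝ ℂ 2 volume φ : E → ℂ) =ᵐ[volume] φ :=
          SchwartzMap.coeFn_toLp φ 2
        have h3 := (measurePreserving_add_right volume h).quasiMeasurePreserving.ae h2
        filter_upwards [coeFn_translateLp h (SchwartzMap.toLpCLM ℝ ℂ 2 volume φ), h3,
          SchwartzMap.coeFn_toLp (SchwartzMap.compSubConstCLM ℂ (-h) φ) 2] with x hx1 hx2 hx3
        rw [hx1, hx2, hx3, SchwartzMap.compSubConstCLM_apply, sub_neg_eq_add]
      have h7 : 𝓕 (SchwartzMap.toLpCLM ℝ ℂ 2 volume φ) = (𝓕 φ).toLp 2 :=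
        SchwartzMap.toLp_fourier_eq φ
      rw [h1, SchwartzMap.toLp_fourier_eq, h7]
      refine Lp.ext ?_
      have h2 := SchwartzMap.coeFn_toLp (𝓕 (SchwartzMap.compSubConstCLM ℂ (-h) φ)) 2 volume
      have h3 := SchwartzMap.coeFn_toLp (𝓕 φ) 2 volume
      generalize (𝓕 φ).toLp 2 volume = g at h3 ⊢
      filter_upwards [h2, h3, hm.coeFn_toLp, Lp.coeFn_lpSMul (r := 2) (hm.toLp _) g]
        with x hx1 hx2 hx3 hx4
      rw [hx1, hx4, Pi.smul_apply', hx3, hx2, fourier_compSubConstCLM_neg, smul_eq_mul]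
  rw [key]
  filter_upwards [hm.coeFn_toLp,
    Lp.coeFn_lpSMul (r := 2) (hm.toLp _) (𝓕 f : Lp ℂ 2 (volume : Measure E))] with x hx1 hx2
  rw [hx2, Pi.smul_apply', hx1, smul_eq_mul]

theorem lintegral_enorm_sq_eq (f : Lp ℂ 2 (volume : Measure E)) :
    ∫⁻ x, ‖f x‖ₑ ^ 2 = ‖f‖ₑ ^ 2 := by
  rw [Lp.enorm_def, eLpNorm_eq_lintegral_rpow_enorm_toReal (by norm_num) (by norm_num)]
  rw [← ENNReal.rpow_natCast, ← ENNReal.rpow_mul]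
  norm_num

theorem lintegral_enorm_sq_fourier (f : Lp ℂ 2 (volume : Measure E)) :
    ∫⁻ x, ‖(𝓕 f : Lp ℂ 2 (volume : Measure E)) x‖ₑ ^ 2 = ‖f‖ₑ ^ 2 := by
  rw [lintegral_enorm_sq_eq]
  congr 1
  exact (Lp.fourierTransformₗᵢ E ℂ).enorm_map f

/-- Plancherel's theorem for differences. -/
theorem lintegral_enorm_sub_sq_eq (h : E) (f : Lp ℂ 2 (volume : Measure E)) :
    ∫⁻ x, ‖f (x + h) - f x‖ₑ ^ 2 =
      ∫⁻ ξ, ‖Complex.exp ((2 * Real.pi * inner ℝ h ξ : ℝ) * Complex.I) - 1‖ₑ ^ 2 *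
        ‖(𝓕 f : Lp ℂ 2 (volume : Measure E)) ξ‖ₑ ^ 2 := by
  calc ∫⁻ x, ‖f (x + h) - f x‖ₑ ^ 2 = ∫⁻ x, ‖(translateLp h f - f) x‖ₑ ^ 2 := by
        refine lintegral_congr_ae ?_
        filter_upwards [coeFn_translateLp h f, Lp.coeFn_sub (translateLp h f) f] with x hx1 hx2
        rw [hx2, Pi.sub_apply, hx1]
    _ = ∫⁻ ξ, ‖(𝓕 (translateLp h f - f) : Lp ℂ 2 (volume : Measure E)) ξ‖ₑ ^ 2 := by
        rw [lintegral_enorm_sq_fourier, lintegral_enorm_sq_eq]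
    _ = _ := by
        have e : 𝓕 (translateLp h f - f) = 𝓕 (translateLp h f) - 𝓕 f :=
          map_sub (Lp.fourierTransformₗᵢ E ℂ) _ _
        refine lintegral_congr_ae ?_
        filter_upwards [fourier_translateLp h f,
          Lp.coeFn_sub (𝓕 (translateLp h f)) (𝓕 f)] with ξ h1 h2
        rw [e, h2, Pi.sub_apply, h1, ← mul_pow, ← enorm_mul, sub_mul, one_mul]

end Translation

/-! ### The norm of `H^s` in terms of differences, for `0 ≤ s ≤ 1` -/

section Energy

variable {n : ℕ}

/-- The square `∫ (1 + |ξ|²)^s |𝓕 f|²` of the `H^s` norm of a square integrable function, as an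
extended nonnegative number. -/
noncomputable def sobolevEnergy (s : ℝ)
    (f : Lp ℂ 2 (volume : Measure (EuclideanSpace ℝ (Fin n)))) : ℝ≥0∞ :=
  ∫⁻ ξ, ENNReal.ofReal ((1 + ‖ξ‖ ^ 2) ^ s) *
    ‖(𝓕 f : Lp ℂ 2 (volume : Measure (EuclideanSpace ℝ (Fin n)))) ξ‖ₑ ^ 2

/-- The sum over the coordinate directions of the squared `L²` norms of the differences of `f` with
step `2⁻ᵏ`. -/
noncomputable def dyadicDiff (f : EuclideanSpace ℝ (Fin n) → ℂ) (k : ℕ) : ℝ≥0∞ :=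
  ∑ i, ∫⁻ x, ‖f (x + EuclideanSpace.single i (1 / 2 ^ k)) - f x‖ₑ ^ 2

/-- The Fourier symbol of `dyadicDiff`. -/
noncomputable def diffSymbol (k : ℕ) (ξ : EuclideanSpace ℝ (Fin n)) : ℝ≥0∞ :=
  ∑ i, ‖Complex.exp ((2 * Real.pi * inner ℝ (EuclideanSpace.single i (1 / 2 ^ k : ℝ)) ξ : ℝ) *
    Complex.I) - 1‖ₑ ^ 2

@[fun_prop]
theorem measurable_diffSymbol (k : ℕ) : Measurable (diffSymbol (n := n) k) := by
  unfold diffSymbol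
  refine Finset.measurable_sum _ fun i _ => Measurable.pow_const (Continuous.measurable ?_) 2
  fun_prop

theorem dyadicDiff_eq (f : Lp ℂ 2 (volume : Measure (EuclideanSpace ℝ (Fin n)))) (k : ℕ) :
    dyadicDiff f k = ∫⁻ ξ, diffSymbol k ξ *
      ‖(𝓕 f : Lp ℂ 2 (volume : Measure (EuclideanSpace ℝ (Fin n)))) ξ‖ₑ ^ 2 := by
  unfold dyadicDiff diffSymbol
  simp only [lintegral_enorm_sub_sq_eq, Finset.sum_mul]
  rw [lintegral_finsetSum']
  intro i _
  refine AEMeasurable.mul ?_ ((Lp.aestronglyMeasurable _).enorm.pow_const 2)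
  refine (Measurable.pow_const (Continuous.measurable ?_) 2).aemeasurable
  fun_prop

theorem norm_exp_sub_one (θ : ℝ) : ‖Complex.exp (θ * Complex.I) - 1‖ = 2 * |Real.sin (θ / 2)| := by
  rw [mul_comm, Complex.norm_exp_I_mul_ofReal_sub_one, norm_mul, Real.norm_eq_abs,
    Real.norm_eq_abs, abs_two]

theorem diffSymbol_le (k : ℕ) (ξ : EuclideanSpace ℝ (Fin n)) :
    diffSymbol k ξ ≤ ENNReal.ofReal (40 * n) * ENNReal.ofReal (min 1 ((1 + ‖ξ‖ ^ 2) / 4 ^ k)) := by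
  have key : ∀ i : Fin n, ‖Complex.exp ((2 * Real.pi *
      inner ℝ (EuclideanSpace.single i (1 / 2 ^ k : ℝ)) ξ : ℝ) * Complex.I) - 1‖ₑ ^ 2 ≤
      ENNReal.ofReal (40 * min 1 ((1 + ‖ξ‖ ^ 2) / 4 ^ k)) := by
    intro i
    rw [← ofReal_norm, ← ENNReal.ofReal_pow (norm_nonneg _), norm_exp_sub_one]
    apply ENNReal.ofReal_le_ofReal
    rw [EuclideanSpace.inner_single_left, mul_pow, sq_abs]
    set θ := 2 * Real.pi * ((starRingEnd ℝ) (1 / 2 ^ k) * ξ i) / 2 with hθ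
    have e : θ ^ 2 = Real.pi ^ 2 * ξ i ^ 2 / 4 ^ k := by
      rw [hθ, show (4 : ℝ) = 2 ^ 2 by norm_num, ← pow_mul, mul_comm 2 k, pow_mul]
      simp only [conj_trivial]
      field_simp
    have h1 : Real.sin θ ^ 2 ≤ 1 := Real.sin_sq_le_one θ
    have h2 : Real.sin θ ^ 2 ≤ θ ^ 2 := sq_le_sq.2 Real.abs_sin_le_abs
    have h3 : ξ i ^ 2 ≤ 1 + ‖ξ‖ ^ 2 := by
      have := PiLp.norm_apply_le ξ i
      have h4 : |ξ i| ^ 2 ≤ ‖ξ‖ ^ 2 := by gcongr; exact this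
      rw [sq_abs] at h4
      linarith
    have h4 : Real.pi ^ 2 ≤ 10 := by
      have := Real.pi_lt_d2
      nlinarith [Real.pi_pos]
    have h5 : θ ^ 2 ≤ 10 * ((1 + ‖ξ‖ ^ 2) / 4 ^ k) := by
      rw [e, mul_div_assoc]
      gcongr
    rcases min_cases 1 ((1 + ‖ξ‖ ^ 2) / 4 ^ k) with ⟨h, _⟩ | ⟨h, _⟩ <;> rw [h] <;> linarith
  calc diffSymbol k ξ ≤ ∑ _i : Fin n, ENNReal.ofReal (40 * min 1 ((1 + ‖ξ‖ ^ 2) / 4 ^ k)) :=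
        Finset.sum_le_sum fun i _ => key i
    _ = _ := by
        rw [Finset.sum_const, Finset.card_univ, Fintype.card_fin, nsmul_eq_mul,
          ← ENNReal.ofReal_natCast, ← ENNReal.ofReal_mul (by positivity),
          ← ENNReal.ofReal_mul (by positivity)]
        congr 1
        ring

/-- For `2 |ξ| ≤ 2ᵏ` the phases `2⁻ᵏ π ξᵢ` are at most `π / 2`, where `|sin θ| ≥ 2 |θ| / π`. -/
theorem le_diffSymbol {k : ℕ} {ξ : EuclideanSpace ℝ (Fin n)} (h : 2 * ‖ξ‖ ≤ 2 ^ k) :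
    ENNReal.ofReal (16 * ‖ξ‖ ^ 2 / 4 ^ k) ≤ diffSymbol k ξ := by
  have key : ∀ i : Fin n, ENNReal.ofReal (16 * ξ i ^ 2 / 4 ^ k) ≤ ‖Complex.exp ((2 * Real.pi *
      inner ℝ (EuclideanSpace.single i (1 / 2 ^ k : ℝ)) ξ : ℝ) * Complex.I) - 1‖ₑ ^ 2 := by
    intro i
    rw [← ofReal_norm, ← ENNReal.ofReal_pow (norm_nonneg _), norm_exp_sub_one]
    apply ENNReal.ofReal_le_ofReal
    rw [EuclideanSpace.inner_single_left]
    set θ := 2 * Real.pi * ((starRingEnd ℝ) (1 / 2 ^ k) * ξ i) / 2 with hθ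
    have e : |θ| = Real.pi * (|ξ i| / 2 ^ k) := by
      have : θ = Real.pi * (ξ i / 2 ^ k) := by
        rw [hθ]
        simp only [conj_trivial]
        ring
      rw [this, abs_mul, abs_div, abs_of_pos Real.pi_pos, abs_of_pos (by positivity : (0:ℝ) < 2 ^ k)]
    have h1 : |ξ i| / 2 ^ k ≤ 1 / 2 := by
      have h2 : |ξ i| ≤ ‖ξ‖ := PiLp.norm_apply_le ξ i
      rw [div_le_iff₀ (by positivity)]
      linarith
    have h3 : 2 / Real.pi * |θ| ≤ |Real.sin θ| := by
      refine Real.mul_abs_le_abs_sin ?_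
      rw [e]
      nlinarith [Real.pi_pos]
    have h4 : 2 * (|ξ i| / 2 ^ k) ≤ |Real.sin θ| := by
      refine le_of_eq_of_le ?_ h3
      rw [e]
      field_simp
    calc 16 * ξ i ^ 2 / 4 ^ k = (2 * (2 * (|ξ i| / 2 ^ k))) ^ 2 := by
          rw [show (4 : ℝ) = 2 ^ 2 by norm_num, ← pow_mul, mul_comm 2 k, pow_mul, ← sq_abs (ξ i)]
          ring_nf
      _ ≤ _ := by gcongr
  calc ENNReal.ofReal (16 * ‖ξ‖ ^ 2 / 4 ^ k) = ∑ i, ENNReal.ofReal (16 * ξ i ^ 2 / 4 ^ k) := by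
        rw [← ENNReal.ofReal_sum_of_nonneg fun i _ => by positivity, EuclideanSpace.real_norm_sq_eq,
          ← Finset.sum_div, Finset.mul_sum]
    _ ≤ _ := Finset.sum_le_sum fun i _ => key i

theorem exists_dyadicSum_diffSymbol_le {s : ℝ} (hs0 : 0 < s) (hs1 : s ≤ 1) :
    ∃ C : ℝ≥0∞, C ≠ ∞ ∧ ∀ ξ : EuclideanSpace ℝ (Fin n),
      dyadicSum s (fun k => diffSymbol k ξ) ≤ C * ENNReal.ofReal ((1 + ‖ξ‖ ^ 2) ^ s) := by
  obtain ⟨C, hC, h⟩ := exists_dyadicSum_min_le hs0 hs1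
  refine ⟨ENNReal.ofReal (40 * n) * C, by finiteness, fun ξ => ?_⟩
  refine (dyadicSum_mono fun k => diffSymbol_le k ξ).trans ?_
  rw [dyadicSum_const_mul, mul_assoc]
  gcongr
  exact h _ (by linarith [sq_nonneg ‖ξ‖])

theorem rpow_le_dyadicSum_diffSymbol {s : ℝ} (hs0 : 0 < s) (hs1 : s ≤ 1)
    (ξ : EuclideanSpace ℝ (Fin n)) :
    ENNReal.ofReal ((1 + ‖ξ‖ ^ 2) ^ s) ≤ 2 + dyadicSum s (fun k => diffSymbol k ξ) := by
  rcases le_total ‖ξ‖ 1 with h | h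
  · refine le_add_right ?_
    refine (ENNReal.ofReal_le_ofReal (q := 2) ?_).trans (by simp)
    calc (1 + ‖ξ‖ ^ 2) ^ s ≤ (1 + ‖ξ‖ ^ 2) ^ (1 : ℝ) := by
          gcongr
          linarith [sq_nonneg ‖ξ‖]
      _ ≤ 2 := by
          rw [Real.rpow_one]
          nlinarith [norm_nonneg ξ]
  · refine le_add_left ?_
    obtain ⟨m, hm1, hm2⟩ := exists_nat_pow_near (by linarith : 1 ≤ 2 * ‖ξ‖) (one_lt_two)
    refine le_trans ?_ (le_dyadicSum s _ (m + 1))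
    refine le_trans ?_ (mul_le_mul_right (le_diffSymbol hm2.le) _)
    rw [← ENNReal.ofReal_mul (by positivity)]
    apply ENNReal.ofReal_le_ofReal
    have h4 : (4 : ℝ) ^ (m + 1) ≤ 16 * ‖ξ‖ ^ 2 := by
      calc (4 : ℝ) ^ (m + 1) = (2 * 2 ^ m) ^ 2 := by
            rw [show (4 : ℝ) = 2 ^ 2 by norm_num, ← pow_mul]
            ring
        _ ≤ (2 * (2 * ‖ξ‖)) ^ 2 := by gcongr
        _ = _ := by ring
    have h5 : 0 < ‖ξ‖ := by linarith
    calc (1 + ‖ξ‖ ^ 2) ^ s ≤ (16 * ‖ξ‖ ^ 2) ^ s := by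
          gcongr
          nlinarith
      _ = (16 * ‖ξ‖ ^ 2) ^ (s - 1) * (16 * ‖ξ‖ ^ 2) := by
          rw [Real.rpow_sub_one (by positivity)]
          field_simp
      _ ≤ ((4 : ℝ) ^ (m + 1)) ^ (s - 1) * (16 * ‖ξ‖ ^ 2) := by
          gcongr ?_ * _
          exact Real.rpow_le_rpow_of_nonpos (by positivity) h4 (by linarith)
      _ = _ := by
          rw [Real.rpow_sub_one (by positivity)]
          ring

theorem aemeasurable_fourier_sq (f : Lp ℂ 2 (volume : Measure (EuclideanSpace ℝ (Fin n)))) :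
    AEMeasurable (fun ξ => ‖(𝓕 f : Lp ℂ 2 (volume : Measure (EuclideanSpace ℝ (Fin n)))) ξ‖ₑ ^ 2)
      volume :=
  (Lp.aestronglyMeasurable _).enorm.pow_const 2

/-- The differences of `f` are controlled by its `H^s` norm. -/
theorem exists_dyadicSum_dyadicDiff_le (n : ℕ) {s : ℝ} (hs0 : 0 < s) (hs1 : s ≤ 1) :
    ∃ C : ℝ≥0∞, C ≠ ∞ ∧ ∀ f : Lp ℂ 2 (volume : Measure (EuclideanSpace ℝ (Fin n))),
      dyadicSum s (dyadicDiff f) ≤ C * sobolevEnergy s f := by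
  obtain ⟨C, hC, h⟩ := exists_dyadicSum_diffSymbol_le (n := n) hs0 hs1
  refine ⟨C, hC, fun f => ?_⟩
  have hm := aemeasurable_fourier_sq f
  have h2 : ∀ k, AEMeasurable (fun ξ => diffSymbol k ξ *
      ‖(𝓕 f : Lp ℂ 2 (volume : Measure (EuclideanSpace ℝ (Fin n)))) ξ‖ₑ ^ 2) volume :=
    fun k => (measurable_diffSymbol k).aemeasurable.mul hm
  have h3 : ∫⁻ ξ, dyadicSum s (fun k => diffSymbol k ξ) *
      ‖(𝓕 f : Lp ℂ 2 (volume : Measure (EuclideanSpace ℝ (Fin n)))) ξ‖ₑ ^ 2 ≤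
      C * sobolevEnergy s f := by
    rw [sobolevEnergy, ← lintegral_const_mul' _ _ hC]
    refine lintegral_mono fun ξ => ?_
    rw [← mul_assoc]
    gcongr
    exact h ξ
  refine le_trans ?_ h3
  rcases lt_or_ge s 1 with hs | hs
  · rw [dyadicSum, if_pos hs]
    simp only [dyadicDiff_eq]
    simp_rw [← lintegral_const_mul'' _ (h2 _)]
    rw [← lintegral_tsum fun k => (h2 k).const_mul _]
    refine lintegral_mono fun ξ => ?_
    simp only
    rw [dyadicSum, if_pos hs, ← ENNReal.tsum_mul_right]
    simp only [mul_assoc]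
    exact le_rfl
  · refine dyadicSum_le_of_term hs.not_gt fun k => ?_
    rw [dyadicDiff_eq, ← lintegral_const_mul'' _ (h2 _)]
    refine lintegral_mono fun ξ => ?_
    simp only
    rw [← mul_assoc]
    gcongr
    exact le_dyadicSum s (fun k => diffSymbol k ξ) k

/-- The `H^s` norm of `f` is controlled by its `L²` norm and its differences. -/
theorem sobolevEnergy_le_dyadicSum {s : ℝ} (hs0 : 0 < s) (hs1 : s ≤ 1)
    (f : Lp ℂ 2 (volume : Measure (EuclideanSpace ℝ (Fin n)))) :
    sobolevEnergy s f ≤ 2 * ‖f‖ₑ ^ 2 + dyadicSum s (dyadicDiff f) := by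
  have hm := aemeasurable_fourier_sq f
  have h2 : ∀ k, AEMeasurable (fun ξ => diffSymbol k ξ *
      ‖(𝓕 f : Lp ℂ 2 (volume : Measure (EuclideanSpace ℝ (Fin n)))) ξ‖ₑ ^ 2) volume :=
    fun k => (measurable_diffSymbol k).aemeasurable.mul hm
  rcases hs1.lt_or_eq with hs | rfl
  · have h1 : ∫⁻ ξ, dyadicSum s (fun k => diffSymbol k ξ) *
        ‖(𝓕 f : Lp ℂ 2 (volume : Measure (EuclideanSpace ℝ (Fin n)))) ξ‖ₑ ^ 2 =
        dyadicSum s (dyadicDiff f) := by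
      simp only [dyadicSum, if_pos hs, dyadicDiff_eq]
      simp_rw [← lintegral_const_mul'' _ (h2 _)]
      rw [← lintegral_tsum fun k => (h2 k).const_mul _]
      simp only [← ENNReal.tsum_mul_right, mul_assoc]
    rw [← h1, ← lintegral_enorm_sq_fourier, ← lintegral_const_mul'' _ hm,
      ← lintegral_add_left' (hm.const_mul _), sobolevEnergy]
    refine lintegral_mono fun ξ => ?_
    simp only
    rw [← add_mul]
    gcongr
    exact rpow_le_dyadicSum_diffSymbol hs0 hs1 ξ
  · -- The low frequencies `2 |ξ| ≤ 2ᵏ` are controlled by the differences with step `2⁻ᵏ`.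
    have hU : (⋃ k : ℕ, {ξ : EuclideanSpace ℝ (Fin n) | 2 * ‖ξ‖ ≤ 2 ^ k}) = Set.univ := by
      refine Set.eq_univ_of_forall fun ξ => Set.mem_iUnion.2 ?_
      obtain ⟨k, hk⟩ := pow_unbounded_of_one_lt (2 * ‖ξ‖) one_lt_two
      exact ⟨k, hk.le⟩
    have hmono : Monotone fun k : ℕ => {ξ : EuclideanSpace ℝ (Fin n) | 2 * ‖ξ‖ ≤ 2 ^ k} := by
      intro k l hkl ξ hξ
      refine le_trans (Set.mem_ofPred.1 hξ) ?_
      exact pow_le_pow_right₀ one_le_two hkl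
    rw [sobolevEnergy, ← setLIntegral_univ, ← hU,
      setLIntegral_iUnion_of_directed _ hmono.directed_le]
    refine iSup_le fun k => ?_
    have hset : MeasurableSet {ξ : EuclideanSpace ℝ (Fin n) | 2 * ‖ξ‖ ≤ 2 ^ k} :=
      (isClosed_le (by fun_prop) (by fun_prop)).measurableSet
    calc _ ≤ ∫⁻ ξ in {ξ : EuclideanSpace ℝ (Fin n) | 2 * ‖ξ‖ ≤ 2 ^ k},
          (2 + ENNReal.ofReal (((4 : ℝ) ^ k) ^ (1 : ℝ)) * diffSymbol k ξ) *
            ‖(𝓕 f : Lp ℂ 2 (volume : Measure (EuclideanSpace ℝ (Fin n)))) ξ‖ₑ ^ 2 := by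
          refine setLIntegral_mono' hset fun ξ hξ => ?_
          gcongr
          have h3 := le_diffSymbol hξ
          calc ENNReal.ofReal ((1 + ‖ξ‖ ^ 2) ^ (1 : ℝ))
              ≤ ENNReal.ofReal 2 + ENNReal.ofReal (4 ^ k * (16 * ‖ξ‖ ^ 2 / 4 ^ k)) := by
                rw [← ENNReal.ofReal_add (by norm_num) (by positivity), Real.rpow_one]
                apply ENNReal.ofReal_le_ofReal
                rw [mul_div_cancel₀ _ (by positivity)]
                nlinarith [sq_nonneg ‖ξ‖]
            _ ≤ _ := by
                rw [ENNReal.ofReal_mul (by positivity), Real.rpow_one]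
                gcongr
                simp
      _ ≤ ∫⁻ ξ, (2 + ENNReal.ofReal (((4 : ℝ) ^ k) ^ (1 : ℝ)) * diffSymbol k ξ) *
            ‖(𝓕 f : Lp ℂ 2 (volume : Measure (EuclideanSpace ℝ (Fin n)))) ξ‖ₑ ^ 2 :=
          setLIntegral_le_lintegral _ _
      _ = 2 * ‖f‖ₑ ^ 2 + ENNReal.ofReal (((4 : ℝ) ^ k) ^ (1 : ℝ)) * dyadicDiff f k := by
          simp only [add_mul, mul_assoc]
          rw [lintegral_add_left' (hm.const_mul _), lintegral_const_mul'' _ hm,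
            lintegral_const_mul'' _ (h2 k), lintegral_enorm_sq_fourier, dyadicDiff_eq]
      _ ≤ _ := by
          gcongr
          exact le_dyadicSum 1 (dyadicDiff f) k

theorem sobolevEnergy_zero (f : Lp ℂ 2 (volume : Measure (EuclideanSpace ℝ (Fin n)))) :
    sobolevEnergy 0 f = ‖f‖ₑ ^ 2 := by
  simp [sobolevEnergy, lintegral_enorm_sq_fourier]

theorem enorm_sq_le_sobolevEnergy {s : ℝ} (hs : 0 ≤ s)
    (f : Lp ℂ 2 (volume : Measure (EuclideanSpace ℝ (Fin n)))) :
    ‖f‖ₑ ^ 2 ≤ sobolevEnergy s f := by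
  rw [← lintegral_enorm_sq_fourier, sobolevEnergy]
  refine lintegral_mono fun ξ => ?_
  refine le_mul_of_one_le_left (by positivity) ?_
  rw [ENNReal.one_le_ofReal]
  exact Real.one_le_rpow (by linarith [sq_nonneg ‖ξ‖]) hs

/-- If the differences of `g` are dominated by those of `f` and a further sequence `m`, then the `H^s`
norm of `g` is dominated accordingly. -/
theorem exists_sobolevEnergy_le (n : ℕ) {s : ℝ} (hs0 : 0 ≤ s) (hs1 : s ≤ 1) :
    ∃ C : ℝ≥0∞, C ≠ ∞ ∧ ∀ (f g : Lp ℂ 2 (volume : Measure (EuclideanSpace ℝ (Fin n))))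
      (a : ℝ≥0∞) (m : ℕ → ℝ≥0∞), (∀ k, dyadicDiff g k ≤ a * dyadicDiff f k + m k) →
      sobolevEnergy s g ≤ C * (‖g‖ₑ ^ 2 + a * sobolevEnergy s f + dyadicSum s m) := by
  rcases hs0.eq_or_lt with rfl | hs0
  · refine ⟨1, by simp, fun f g a m _ => ?_⟩
    rw [sobolevEnergy_zero, one_mul, add_assoc]
    exact le_self_add
  obtain ⟨C, hC, h⟩ := exists_dyadicSum_dyadicDiff_le n hs0 hs1
  refine ⟨C + 2, by finiteness, fun f g a m hgf => ?_⟩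
  calc sobolevEnergy s g ≤ 2 * ‖g‖ₑ ^ 2 + dyadicSum s (dyadicDiff g) :=
        sobolevEnergy_le_dyadicSum hs0 hs1 g
    _ ≤ 2 * ‖g‖ₑ ^ 2 + (a * (C * sobolevEnergy s f) + dyadicSum s m) := by
        gcongr
        refine (dyadicSum_mono hgf).trans ((dyadicSum_add_le _ _ _).trans ?_)
        rw [dyadicSum_const_mul]
        gcongr
        exact h f
    _ = 2 * ‖g‖ₑ ^ 2 + C * (a * sobolevEnergy s f) + 1 * dyadicSum s m := by ring
    _ ≤ (C + 2) * ‖g‖ₑ ^ 2 + (C + 2) * (a * sobolevEnergy s f) + (C + 2) * dyadicSum s m := by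
        gcongr
        · exact le_add_self
        · exact le_self_add
        · exact one_le_two.trans le_add_self
    _ = _ := by ring

end Energy

/-! ### Sobolev spaces of nonnegative order and square integrable functions -/

section Bessel

variable {n : ℕ}

/-- The Bessel potential operator `J_s` on Schwartz functions. -/
noncomputable def besselSchwartz (s : ℝ) (φ : 𝓢(EuclideanSpace ℝ (Fin n), ℂ)) :
    𝓢(EuclideanSpace ℝ (Fin n), ℂ) :=
  SchwartzMap.fourierMultiplierCLM ℂ
    (fun ξ : EuclideanSpace ℝ (Fin n) => (((1 + ‖ξ‖ ^ 2) ^ (s / 2) : ℝ) : ℂ)) φ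

theorem hasTemperateGrowth_weight (s : ℝ) : Function.HasTemperateGrowth
    (fun ξ : EuclideanSpace ℝ (Fin n) => (((1 + ‖ξ‖ ^ 2) ^ (s / 2) : ℝ) : ℂ)) := by
  fun_prop

theorem besselSchwartz_besselSchwartz (s t : ℝ) (φ : 𝓢(EuclideanSpace ℝ (Fin n), ℂ)) :
    besselSchwartz s (besselSchwartz t φ) = besselSchwartz (s + t) φ := by
  unfold besselSchwartz
  rw [SchwartzMap.fourierMultiplierCLM_fourierMultiplierCLM_apply (hasTemperateGrowth_weight s)
    (hasTemperateGrowth_weight t)]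
  congr 2
  ext ξ
  rw [Pi.mul_apply, ← Complex.ofReal_mul, ← Real.rpow_add (by positivity)]
  ring_nf

theorem besselSchwartz_zero (φ : 𝓢(EuclideanSpace ℝ (Fin n), ℂ)) : besselSchwartz 0 φ = φ := by
  simp [besselSchwartz]

/-- The Bessel potential operator on distributions is the transpose of the one on Schwartz functions,
since its symbol is even. -/
theorem besselPotential_apply (s : ℝ) (u : 𝓢'(EuclideanSpace ℝ (Fin n), ℂ))
    (φ : 𝓢(EuclideanSpace ℝ (Fin n), ℂ)) :
    TemperedDistribution.besselPotential (EuclideanSpace ℝ (Fin n)) ℂ s u φ =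
      u (besselSchwartz s φ) := by
  have hg := hasTemperateGrowth_weight (n := n) s
  rw [TemperedDistribution.besselPotential, TemperedDistribution.fourierMultiplierCLM_apply_apply,
    besselSchwartz, SchwartzMap.fourierMultiplierCLM_apply]
  congr 1
  ext x
  rw [SchwartzMap.fourierInv_coe, SchwartzMap.fourier_coe, Real.fourierInv_eq_fourier_comp_neg]
  refine congrArg (fun F : EuclideanSpace ℝ (Fin n) → ℂ => 𝓕 F x) (funext fun ξ => ?_)
  rw [SchwartzMap.smulLeftCLM_apply_apply hg, SchwartzMap.smulLeftCLM_apply_apply hg, norm_neg,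
    SchwartzMap.fourierInv_coe, SchwartzMap.fourier_coe, Real.fourierInv_eq_fourier_neg]

theorem toL2_ofSchwartz (s : ℝ) (φ : 𝓢(EuclideanSpace ℝ (Fin n), ℂ)) :
    SobolevH.toL2 (SobolevH.ofSchwartz s φ) = (besselSchwartz s φ).toLp 2 := by
  apply SobolevH.eq_of_coe_eq
  rw [← SobolevH.toL2_spec, Lp.toTemperedDistribution_toLp_eq]
  exact TemperedDistribution.fourierMultiplierCLM_toTemperedDistributionCLM_eq
    (hasTemperateGrowth_weight s) φ

/-- For `s ≥ 0` the operator `J_{-s}` maps `L²` to `L²`. -/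
theorem exists_lp_eq_besselPotential_neg {s : ℝ} (hs : 0 ≤ s)
    (h : Lp ℂ 2 (volume : Measure (EuclideanSpace ℝ (Fin n)))) :
    ∃ f : Lp ℂ 2 (volume : Measure (EuclideanSpace ℝ (Fin n))),
      (f : 𝓢'(EuclideanSpace ℝ (Fin n), ℂ)) =
        TemperedDistribution.besselPotential (EuclideanSpace ℝ (Fin n)) ℂ (-s) h ∧
      ((𝓕 f : Lp ℂ 2 (volume : Measure (EuclideanSpace ℝ (Fin n)))) :
        EuclideanSpace ℝ (Fin n) → ℂ) =ᵐ[volume] fun ξ =>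
          (((1 + ‖ξ‖ ^ 2) ^ (-s / 2) : ℝ) : ℂ) *
            (𝓕 h : Lp ℂ 2 (volume : Measure (EuclideanSpace ℝ (Fin n)))) ξ := by
  have hg := hasTemperateGrowth_weight (n := n) (-s)
  have hm : MemLp (fun ξ : EuclideanSpace ℝ (Fin n) => (((1 + ‖ξ‖ ^ 2) ^ (-s / 2) : ℝ) : ℂ))
      ∞ volume := by
    refine memLp_top_of_bound hg.1.continuous.aestronglyMeasurable 1 (ae_of_all _ fun ξ => ?_)
    rw [Complex.norm_real, Real.norm_of_nonneg (by positivity)]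
    exact Real.rpow_le_one_of_one_le_of_nonpos (by linarith [sq_nonneg ‖ξ‖]) (by linarith)
  refine ⟨𝓕⁻ (hm.toLp _ • (𝓕 h : Lp ℂ 2 (volume : Measure (EuclideanSpace ℝ (Fin n)))) :
    Lp ℂ 2 (volume : Measure (EuclideanSpace ℝ (Fin n)))), ?_, ?_⟩
  · rw [← Lp.fourierInv_toTemperedDistribution_eq, Lp.toTemperedDistribution_smul_eq hg hm,
      ← Lp.fourier_toTemperedDistribution_eq]
    rfl
  · rw [FourierTransform.fourier_fourierInv_eq]
    filter_upwards [hm.coeFn_toLp, Lp.coeFn_lpSMul (r := 2) (hm.toLp _)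
      (𝓕 h : Lp ℂ 2 (volume : Measure (EuclideanSpace ℝ (Fin n))))] with ξ h1 h2
    rw [h2, Pi.smul_apply', h1, smul_eq_mul]

theorem enorm_weight_sq (s : ℝ) (ξ : EuclideanSpace ℝ (Fin n)) :
    ‖(((1 + ‖ξ‖ ^ 2) ^ (s / 2) : ℝ) : ℂ)‖ₑ ^ 2 = ENNReal.ofReal ((1 + ‖ξ‖ ^ 2) ^ s) := by
  rw [← ofReal_norm, ← ENNReal.ofReal_pow (norm_nonneg _), Complex.norm_real,
    Real.norm_of_nonneg (by positivity), ← Real.rpow_mul_natCast (by positivity)]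
  congr 2
  push_cast
  ring

/-- For `s ≥ 0` the elements of `H^s` are square integrable functions. -/
theorem SobolevH.exists_lp_eq_toDistr {s : ℝ} (hs : 0 ≤ s) (u : SobolevH n s) :
    ∃ f : Lp ℂ 2 (volume : Measure (EuclideanSpace ℝ (Fin n))),
      SobolevH.toDistr u = (f : 𝓢'(EuclideanSpace ℝ (Fin n), ℂ)) ∧
      sobolevEnergy s f = ‖SobolevH.toL2 u‖ₑ ^ 2 := by
  obtain ⟨f, hf1, hf2⟩ := exists_lp_eq_besselPotential_neg hs (SobolevH.toL2 u)
  refine ⟨f, ?_, ?_⟩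
  · rw [hf1, ← SobolevH.toL2_spec]
    simp
  · rw [← lintegral_enorm_sq_fourier, sobolevEnergy]
    refine lintegral_congr_ae ?_
    filter_upwards [hf2] with ξ h1
    rw [h1, enorm_mul, mul_pow, enorm_weight_sq, ← mul_assoc, ← ENNReal.ofReal_mul (by positivity),
      ← Real.rpow_add (by positivity)]
    simp

theorem exists_sobolevH_of_energy_ne_top {s : ℝ} (hs : 0 ≤ s)
    {f : Lp ℂ 2 (volume : Measure (EuclideanSpace ℝ (Fin n)))} (hf : sobolevEnergy s f ≠ ∞) :
    ∃ u : SobolevH n s, SobolevH.toDistr u = (f : 𝓢'(EuclideanSpace ℝ (Fin n), ℂ)) := by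
  set g : EuclideanSpace ℝ (Fin n) → ℂ := fun ξ => (((1 + ‖ξ‖ ^ 2) ^ (s / 2) : ℝ) : ℂ) *
    (𝓕 f : Lp ℂ 2 (volume : Measure (EuclideanSpace ℝ (Fin n)))) ξ with hg
  have hgm : MemLp g 2 volume := by
    refine ⟨(hasTemperateGrowth_weight s).1.continuous.aestronglyMeasurable.mul
      (Lp.aestronglyMeasurable _), ?_⟩
    rw [eLpNorm_lt_top_iff_lintegral_rpow_enorm_lt_top (by norm_num) (by norm_num)]
    refine lt_of_eq_of_lt ?_ (lt_top_iff_ne_top.2 hf)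
    rw [sobolevEnergy]
    refine lintegral_congr fun ξ => ?_
    rw [hg]
    simp only
    rw [enorm_mul, ENNReal.toReal_ofNat, ENNReal.rpow_ofNat, mul_pow, enorm_weight_sq]
  obtain ⟨f', hf1, hf2⟩ := exists_lp_eq_besselPotential_neg hs (𝓕⁻ (hgm.toLp g))
  have e : f' = f := by
    apply (Lp.fourierTransformₗᵢ (EuclideanSpace ℝ (Fin n)) ℂ).injective
    change 𝓕 f' = 𝓕 f
    refine Lp.ext ?_
    rw [FourierTransform.fourier_fourierInv_eq] at hf2
    filter_upwards [hf2, hgm.coeFn_toLp] with ξ h1 h2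
    rw [h1, h2, hg]
    simp only
    rw [← mul_assoc, ← Complex.ofReal_mul, ← Real.rpow_add (by positivity)]
    simp [neg_div]
  refine ⟨⟨(f : 𝓢'(EuclideanSpace ℝ (Fin n), ℂ)), ?_⟩, rfl⟩
  refine ⟨𝓕⁻ (hgm.toLp g), ?_⟩
  rw [← e, hf1]
  simp

end Bessel

/-! ### Pairing with a square integrable function -/

section Pairing

variable {n : ℕ}

theorem integral_mul_eq_inner (h b : Lp ℂ 2 (volume : Measure (EuclideanSpace ℝ (Fin n)))) :
    ∫ x, h x * b x = inner ℂ (star b) h := by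
  rw [L2.inner_def]
  refine integral_congr_ae ?_
  filter_upwards [Lp.coeFn_star b] with x hx
  rw [hx]
  simp

theorem integral_mul_sub_right (h b b' : Lp ℂ 2 (volume : Measure (EuclideanSpace ℝ (Fin n)))) :
    ∫ x, h x * (b - b') x = (∫ x, h x * b x) - ∫ x, h x * b' x := by
  rw [integral_mul_eq_inner, integral_mul_eq_inner, integral_mul_eq_inner, ← inner_sub_left]
  congr 1
  refine Lp.ext ?_
  filter_upwards [Lp.coeFn_star b, Lp.coeFn_star b', Lp.coeFn_star (b - b'), Lp.coeFn_sub b b',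
    Lp.coeFn_sub (star b) (star b')] with x h1 h2 h3 h4 h5
  rw [h3, h5, Pi.sub_apply, Pi.star_apply, h4, h1, h2, Pi.sub_apply, star_sub]
  rfl

theorem norm_integral_mul_le (h b : Lp ℂ 2 (volume : Measure (EuclideanSpace ℝ (Fin n)))) :
    ‖∫ x, h x * b x‖ ≤ ‖h‖ * ‖b‖ := by
  rw [integral_mul_eq_inner]
  refine (norm_inner_le_norm _ _).trans_eq ?_
  have : ‖star b‖ = ‖b‖ := by
    rw [Lp.norm_def, Lp.norm_def]
    congr 1
    refine eLpNorm_congr_norm_ae ?_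
    filter_upwards [Lp.coeFn_star b] with x hx
    rw [hx, Pi.star_apply, norm_star]
  rw [this, mul_comm]

theorem integral_mul_toLp (h : Lp ℂ 2 (volume : Measure (EuclideanSpace ℝ (Fin n))))
    (φ : 𝓢(EuclideanSpace ℝ (Fin n), ℂ)) :
    ∫ x, h x * (φ.toLp 2 volume : Lp ℂ 2 (volume : Measure (EuclideanSpace ℝ (Fin n)))) x =
      (h : 𝓢'(EuclideanSpace ℝ (Fin n), ℂ)) φ := by
  rw [Lp.toTemperedDistribution_apply]
  refine integral_congr_ae ?_
  filter_upwards [SchwartzMap.coeFn_toLp φ 2 volume] with x hx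
  rw [hx, smul_eq_mul, mul_comm]

/-- Bounded sequences in `L²` that converge as distributions converge weakly. -/
theorem tendsto_integral_mul_of_tendsto_distr
    {h : ℕ → Lp ℂ 2 (volume : Measure (EuclideanSpace ℝ (Fin n)))}
    {h₀ : Lp ℂ 2 (volume : Measure (EuclideanSpace ℝ (Fin n)))} {C : ℝ} (hC : ∀ j, ‖h j‖ ≤ C)
    (hlim : ∀ φ : 𝓢(EuclideanSpace ℝ (Fin n), ℂ),
      Tendsto (fun j => (h j : 𝓢'(EuclideanSpace ℝ (Fin n), ℂ)) φ) atTop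
        (𝓝 ((h₀ : 𝓢'(EuclideanSpace ℝ (Fin n), ℂ)) φ)))
    (b : Lp ℂ 2 (volume : Measure (EuclideanSpace ℝ (Fin n)))) :
    Tendsto (fun j => ∫ x, h j x * b x) atTop (𝓝 (∫ x, h₀ x * b x)) := by
  rw [Metric.tendsto_atTop]
  intro ε hε
  have hC0 : 0 ≤ C := (norm_nonneg _).trans (hC 0)
  obtain ⟨φ, hφ⟩ := (SchwartzMap.denseRange_toLpCLM (p := 2) (F := ℂ)
    (E := EuclideanSpace ℝ (Fin n)) (μ := volume) ENNReal.ofNat_ne_top).exists_dist_lt b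
      (by positivity : 0 < ε / (2 * (C + ‖h₀‖ + 1)))
  set ψ : Lp ℂ 2 (volume : Measure (EuclideanSpace ℝ (Fin n))) := φ.toLp 2 with hψ
  have hφ' : ‖b - ψ‖ < ε / (2 * (C + ‖h₀‖ + 1)) := by
    rw [← dist_eq_norm]
    exact hφ
  obtain ⟨N, hN⟩ := Metric.tendsto_atTop.1 (hlim φ) (ε / 2) (by positivity)
  refine ⟨N, fun j hj => ?_⟩
  have e : ∀ g : Lp ℂ 2 (volume : Measure (EuclideanSpace ℝ (Fin n))),
      ∫ x, g x * b x = (∫ x, g x * (b - ψ) x) +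
        (g : 𝓢'(EuclideanSpace ℝ (Fin n), ℂ)) φ := by
    intro g
    rw [integral_mul_sub_right, hψ, integral_mul_toLp]
    ring
  rw [dist_eq_norm, e (h j), e h₀]
  have h1 := hN j hj
  rw [dist_eq_norm] at h1
  have h2 := norm_integral_mul_le (h j) (b - ψ)
  have h3 := norm_integral_mul_le h₀ (b - ψ)
  have h4 : ‖h j‖ * ‖b - ψ‖ + ‖h₀‖ * ‖b - ψ‖ ≤ ε / 2 := by
    calc ‖h j‖ * ‖b - ψ‖ + ‖h₀‖ * ‖b - ψ‖
        ≤ (C + ‖h₀‖ + 1) * (ε / (2 * (C + ‖h₀‖ + 1))) := by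
          rw [← add_mul]
          exact mul_le_mul (by linarith [hC j]) hφ'.le (norm_nonneg _) (by positivity)
      _ = ε / 2 := by field_simp
  calc _ = ‖(∫ x, h j x * (b - ψ) x) - (∫ x, h₀ x * (b - ψ) x) +
        ((h j : 𝓢'(EuclideanSpace ℝ (Fin n), ℂ)) φ -
          (h₀ : 𝓢'(EuclideanSpace ℝ (Fin n), ℂ)) φ)‖ := by
        congr 1
        ring
    _ ≤ ‖∫ x, h j x * (b - ψ) x‖ + ‖∫ x, h₀ x * (b - ψ) x‖ + _ :=
        (norm_add_le _ _).trans (by gcongr; exact norm_sub_le _ _)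
    _ < ε := by linarith

/-- The square integrable function `f` is orthogonal to the distribution `J_s b ∈ H^{-s}` in the
duality of `H^s` and `H^{-s}`. Nothing is asserted if `f ∉ H^s`. -/
def OrthogonalTo (s : ℝ) (b f : Lp ℂ 2 (volume : Measure (EuclideanSpace ℝ (Fin n)))) : Prop :=
  ∀ u : SobolevH n s, SobolevH.toDistr u = (f : 𝓢'(EuclideanSpace ℝ (Fin n), ℂ)) →
    ∫ x, SobolevH.toL2 u x * b x = 0

theorem toL2_apply_schwartz {s : ℝ} {u : SobolevH n s}
    {f : Lp ℂ 2 (volume : Measure (EuclideanSpace ℝ (Fin n)))}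
    (h : SobolevH.toDistr u = (f : 𝓢'(EuclideanSpace ℝ (Fin n), ℂ)))
    (φ : 𝓢(EuclideanSpace ℝ (Fin n), ℂ)) :
    (SobolevH.toL2 u : 𝓢'(EuclideanSpace ℝ (Fin n), ℂ)) φ =
      (f : 𝓢'(EuclideanSpace ℝ (Fin n), ℂ)) (besselSchwartz s φ) := by
  rw [← SobolevH.toL2_spec, besselPotential_apply, h]

theorem enorm_toL2_sq {s : ℝ} (hs : 0 ≤ s) {u : SobolevH n s}
    {f : Lp ℂ 2 (volume : Measure (EuclideanSpace ℝ (Fin n)))}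
    (h : SobolevH.toDistr u = (f : 𝓢'(EuclideanSpace ℝ (Fin n), ℂ))) :
    ‖SobolevH.toL2 u‖ₑ ^ 2 = sobolevEnergy s f := by
  obtain ⟨f', hf1, hf2⟩ := SobolevH.exists_lp_eq_toDistr hs u
  rw [← hf2, SobolevH.eq_of_coe_eq (h.symm.trans hf1)]

/-- Orthogonality is preserved under limits of sequences that are bounded in `H^s` and converge as
distributions. -/
theorem OrthogonalTo.of_tendsto {s : ℝ} (hs : 0 ≤ s)
    {b f₀ : Lp ℂ 2 (volume : Measure (EuclideanSpace ℝ (Fin n)))}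
    {f : ℕ → Lp ℂ 2 (volume : Measure (EuclideanSpace ℝ (Fin n)))} {C : ℝ≥0∞} (hC : C ≠ ∞)
    (hbd : ∀ j, sobolevEnergy s (f j) ≤ C)
    (hlim : ∀ φ : 𝓢(EuclideanSpace ℝ (Fin n), ℂ),
      Tendsto (fun j => (f j : 𝓢'(EuclideanSpace ℝ (Fin n), ℂ)) φ) atTop
        (𝓝 ((f₀ : 𝓢'(EuclideanSpace ℝ (Fin n), ℂ)) φ)))
    (hf : ∀ j, OrthogonalTo s b (f j)) : OrthogonalTo s b f₀ := by
  intro u hu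
  choose v hv using fun j => exists_sobolevH_of_energy_ne_top hs (ne_top_of_le_ne_top hC (hbd j))
  have h1 : ∀ j, ‖SobolevH.toL2 (v j)‖ ≤ C.toReal + 1 := by
    intro j
    have h2 : ‖SobolevH.toL2 (v j)‖ₑ ^ 2 ≤ C := (enorm_toL2_sq hs (hv j)).trans_le (hbd j)
    have h3 : ‖SobolevH.toL2 (v j)‖ ^ 2 ≤ C.toReal := by
      have := ENNReal.toReal_mono hC h2
      rwa [ENNReal.toReal_pow, toReal_enorm] at this
    nlinarith [norm_nonneg (SobolevH.toL2 (v j)), sq_nonneg (‖SobolevH.toL2 (v j)‖ - 1)]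
  have h2 := tendsto_integral_mul_of_tendsto_distr h1 (h₀ := SobolevH.toL2 u) (fun φ => by
    simp only [toL2_apply_schwartz (hv _), toL2_apply_schwartz hu]
    exact hlim _) b
  refine tendsto_nhds_unique h2 ?_
  simp only [hf _ _ (hv _)]
  exact tendsto_const_nhds

end Pairing

/-! ### Multiplication and truncation -/

section Multiplication

variable {n : ℕ}

theorem enorm_mul_sub_mul_sq_le (a a' b b' : ℂ) :
    ‖a' * b' - a * b‖ₑ ^ 2 ≤ 2 * (‖a'‖ₑ ^ 2 * ‖b' - b‖ₑ ^ 2) + 2 * (‖a' - a‖ₑ ^ 2 * ‖b‖ₑ ^ 2) := by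
  simp only [← ofReal_norm]
  rw [show (2 : ℝ≥0∞) = ENNReal.ofReal 2 by simp]
  simp only [← ENNReal.ofReal_pow (norm_nonneg _)]
  rw [← ENNReal.ofReal_mul (by positivity), ← ENNReal.ofReal_mul (by positivity),
    ← ENNReal.ofReal_mul (by positivity), ← ENNReal.ofReal_mul (by positivity),
    ← ENNReal.ofReal_add (by positivity) (by positivity)]
  apply ENNReal.ofReal_le_ofReal
  have h : ‖a' * b' - a * b‖ ≤ ‖a'‖ * ‖b' - b‖ + ‖a' - a‖ * ‖b‖ := by
    rw [← norm_mul, ← norm_mul]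
    refine le_trans (le_of_eq ?_) (norm_add_le _ _)
    congr 1
    ring
  calc ‖a' * b' - a * b‖ ^ 2 ≤ (‖a'‖ * ‖b' - b‖ + ‖a' - a‖ * ‖b‖) ^ 2 := by gcongr
    _ ≤ _ := by nlinarith [sq_nonneg (‖a'‖ * ‖b' - b‖ - ‖a' - a‖ * ‖b‖)]

theorem dyadicDiff_congr {f g : EuclideanSpace ℝ (Fin n) → ℂ} (h : f =ᵐ[volume] g) (k : ℕ) :
    dyadicDiff f k = dyadicDiff g k := by
  unfold dyadicDiff
  refine Finset.sum_congr rfl fun i _ => lintegral_congr_ae ?_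
  filter_upwards [h, (measurePreserving_add_right volume
    (EuclideanSpace.single i (1 / 2 ^ k : ℝ))).quasiMeasurePreserving.ae h] with x h1 h2
  rw [h1, h2]

theorem dyadicDiff_comp_le {T : ℂ → ℂ} (hT : ∀ z w, ‖T z - T w‖ ≤ ‖z - w‖)
    (f : EuclideanSpace ℝ (Fin n) → ℂ) (k : ℕ) : dyadicDiff (fun x => T (f x)) k ≤ dyadicDiff f k := by
  refine Finset.sum_le_sum fun i _ => lintegral_mono fun x => ?_
  gcongr
  exact enorm_le_iff_norm_le.2 (hT _ _)

theorem dyadicDiff_mul_le_of_bounded {v f : EuclideanSpace ℝ (Fin n) → ℂ} {M : ℝ}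
    (hv : ∀ x, ‖v x‖ ≤ 1) (hf : ∀ x, ‖f x‖ ≤ M) (hfm : AEStronglyMeasurable f volume) (k : ℕ) :
    dyadicDiff (fun x => v x * f x) k ≤
      2 * dyadicDiff f k + 2 * ENNReal.ofReal M ^ 2 * dyadicDiff v k := by
  unfold dyadicDiff
  rw [Finset.mul_sum, Finset.mul_sum, ← Finset.sum_add_distrib]
  refine Finset.sum_le_sum fun i _ => ?_
  have hfm' := hfm.comp_quasiMeasurePreserving (measurePreserving_add_right volume
    (EuclideanSpace.single i (1 / 2 ^ k : ℝ))).quasiMeasurePreserving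
  have h1 : AEMeasurable (fun x => ‖f (x + EuclideanSpace.single i (1 / 2 ^ k)) - f x‖ₑ ^ 2)
    volume := (hfm'.sub hfm).enorm.pow_const 2
  rw [← lintegral_const_mul'' _ h1, ← lintegral_const_mul' _ _ (by finiteness),
    ← lintegral_add_left' (h1.const_mul _)]
  refine lintegral_mono fun x => (enorm_mul_sub_mul_sq_le _ _ _ _).trans ?_
  have h2 : ‖v (x + EuclideanSpace.single i (1 / 2 ^ k))‖ₑ ≤ 1 := by
    rw [← ofReal_norm, ENNReal.ofReal_le_one]
    exact hv _
  have h3 : ‖f x‖ₑ ≤ ENNReal.ofReal M := by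
    rw [← ofReal_norm]
    exact ENNReal.ofReal_le_ofReal (hf x)
  rw [mul_assoc 2 (ENNReal.ofReal M ^ 2), mul_comm (ENNReal.ofReal M ^ 2)]
  gcongr
  exact mul_le_of_le_one_left' (pow_le_one' h2 2)

theorem dyadicDiff_mul_le_of_lipschitz {v f : EuclideanSpace ℝ (Fin n) → ℂ} {L : ℝ}
    (hv : ∀ x, ‖v x‖ ≤ 1) (hL : ∀ x y, ‖v x - v y‖ ≤ L * ‖x - y‖)
    (hfm : AEStronglyMeasurable f volume) (k : ℕ) :
    dyadicDiff (fun x => v x * f x) k ≤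
      2 * dyadicDiff f k + n * (2 * ENNReal.ofReal (L ^ 2) * ∫⁻ x, ‖f x‖ₑ ^ 2) *
        ENNReal.ofReal (1 / 4 ^ k) := by
  have e : n * (2 * ENNReal.ofReal (L ^ 2) * ∫⁻ x, ‖f x‖ₑ ^ 2) * ENNReal.ofReal (1 / 4 ^ k) =
      ∑ _i : Fin n, 2 * ENNReal.ofReal (L ^ 2) * ENNReal.ofReal (1 / 4 ^ k) *
        ∫⁻ x, ‖f x‖ₑ ^ 2 := by
    rw [Finset.sum_const, Finset.card_univ, Fintype.card_fin, nsmul_eq_mul]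
    ring
  rw [e]
  unfold dyadicDiff
  rw [Finset.mul_sum, ← Finset.sum_add_distrib]
  refine Finset.sum_le_sum fun i _ => ?_
  have hfm' := hfm.comp_quasiMeasurePreserving (measurePreserving_add_right volume
    (EuclideanSpace.single i (1 / 2 ^ k : ℝ))).quasiMeasurePreserving
  have h1 : AEMeasurable (fun x => ‖f (x + EuclideanSpace.single i (1 / 2 ^ k)) - f x‖ₑ ^ 2)
    volume := (hfm'.sub hfm).enorm.pow_const 2
  rw [← lintegral_const_mul'' _ h1, ← lintegral_const_mul' _ _ (by finiteness),
    ← lintegral_add_left' (h1.const_mul _)]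
  refine lintegral_mono fun x => (enorm_mul_sub_mul_sq_le _ _ _ _).trans ?_
  have h2 : ‖v (x + EuclideanSpace.single i (1 / 2 ^ k))‖ₑ ≤ 1 := by
    rw [← ofReal_norm, ENNReal.ofReal_le_one]
    exact hv _
  have h3 : ‖v (x + EuclideanSpace.single i (1 / 2 ^ k)) - v x‖ₑ ^ 2 ≤
      ENNReal.ofReal (L ^ 2) * ENNReal.ofReal (1 / 4 ^ k) := by
    rw [← ofReal_norm, ← ENNReal.ofReal_pow (norm_nonneg _), ← ENNReal.ofReal_mul (by positivity)]
    apply ENNReal.ofReal_le_ofReal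
    have h4 := hL (x + EuclideanSpace.single i (1 / 2 ^ k)) x
    rw [add_sub_cancel_left, PiLp.norm_single, Real.norm_of_nonneg (by positivity)] at h4
    calc _ ≤ (L * (1 / 2 ^ k)) ^ 2 := by gcongr
      _ = _ := by
        rw [mul_pow, one_div_pow, ← pow_mul, mul_comm k 2, pow_mul]
        norm_num
  rw [mul_assoc 2 (ENNReal.ofReal (L ^ 2)), mul_assoc 2]
  gcongr
  exact mul_le_of_le_one_left' (pow_le_one' h2 2)

theorem exists_lp_ae_eq_of_norm_le (f : Lp ℂ 2 (volume : Measure (EuclideanSpace ℝ (Fin n))))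
    {g : EuclideanSpace ℝ (Fin n) → ℂ} (hg : AEStronglyMeasurable g volume)
    (hgf : ∀ᵐ x, ‖g x‖ ≤ ‖f x‖) :
    ∃ G : Lp ℂ 2 (volume : Measure (EuclideanSpace ℝ (Fin n))), G =ᵐ[volume] g ∧ ‖G‖ₑ ≤ ‖f‖ₑ := by
  have h : MemLp g 2 volume := (Lp.memLp f).mono hg hgf
  refine ⟨h.toLp g, h.coeFn_toLp, ?_⟩
  rw [Lp.enorm_def, Lp.enorm_def, eLpNorm_congr_ae h.coeFn_toLp]
  exact eLpNorm_mono_ae hgf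

/-- Bounded Lipschitz functions are multipliers of `H^s` for `0 ≤ s ≤ 1`. -/
theorem exists_sobolevEnergy_mul_le (n : ℕ) {s : ℝ} (hs0 : 0 ≤ s) (hs1 : s ≤ 1) (L : ℝ) :
    ∃ C : ℝ≥0∞, C ≠ ∞ ∧ ∀ v : EuclideanSpace ℝ (Fin n) → ℂ, (∀ x, ‖v x‖ ≤ 1) →
      (∀ x y, ‖v x - v y‖ ≤ L * ‖x - y‖) →
      ∀ f g : Lp ℂ 2 (volume : Measure (EuclideanSpace ℝ (Fin n))),
      (g =ᵐ[volume] fun x => v x * f x) → sobolevEnergy s g ≤ C * sobolevEnergy s f := by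
  obtain ⟨C, hC, h⟩ := exists_sobolevEnergy_le n hs0 hs1
  have hD := dyadicSum_four_inv_pow_ne_top hs1
  set D := dyadicSum s (fun k => ENNReal.ofReal (1 / 4 ^ k))
  refine ⟨C * (1 + 2 + n * (2 * ENNReal.ofReal (L ^ 2)) * D), by finiteness, fun v hv hL f g hg => ?_⟩
  have h1 := h f g 2 _ fun k => (dyadicDiff_congr hg k).trans_le
    (dyadicDiff_mul_le_of_lipschitz hv hL (Lp.aestronglyMeasurable f) k)
  rw [dyadicSum_const_mul, lintegral_enorm_sq_eq] at h1
  have h2 : ‖g‖ₑ ≤ ‖f‖ₑ := by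
    rw [Lp.enorm_def, Lp.enorm_def]
    refine eLpNorm_mono_ae ?_
    filter_upwards [hg] with x hx
    rw [hx, norm_mul]
    exact mul_le_of_le_one_left (norm_nonneg _) (hv x)
  have h3 := enorm_sq_le_sobolevEnergy hs0 f
  refine h1.trans ?_
  rw [mul_assoc C]
  refine mul_le_mul_right ?_ C
  calc ‖g‖ₑ ^ 2 + 2 * sobolevEnergy s f + n * (2 * ENNReal.ofReal (L ^ 2) * ‖f‖ₑ ^ 2) * D
      ≤ sobolevEnergy s f + 2 * sobolevEnergy s f +
          n * (2 * ENNReal.ofReal (L ^ 2) * sobolevEnergy s f) * D := by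
        gcongr
        exact (pow_le_pow_left₀ (by positivity) h2 2).trans h3
    _ = _ := by ring

/-- Contractions of `ℂ` that fix `0` act boundedly on `H^s` for `0 ≤ s ≤ 1`. -/
theorem exists_sobolevEnergy_comp_le (n : ℕ) {s : ℝ} (hs0 : 0 ≤ s) (hs1 : s ≤ 1) :
    ∃ C : ℝ≥0∞, C ≠ ∞ ∧ ∀ T : ℂ → ℂ, (∀ z w, ‖T z - T w‖ ≤ ‖z - w‖) → T 0 = 0 →
      ∀ f g : Lp ℂ 2 (volume : Measure (EuclideanSpace ℝ (Fin n))),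
      (g =ᵐ[volume] fun x => T (f x)) → sobolevEnergy s g ≤ C * sobolevEnergy s f := by
  obtain ⟨C, hC, h⟩ := exists_sobolevEnergy_le n hs0 hs1
  refine ⟨C * 2, by finiteness, fun T hT hT0 f g hg => ?_⟩
  have h1 := h f g 1 0 fun k => by
    rw [dyadicDiff_congr hg k]
    simpa using dyadicDiff_comp_le hT f k
  have h2 : ‖g‖ₑ ≤ ‖f‖ₑ := by
    rw [Lp.enorm_def, Lp.enorm_def]
    refine eLpNorm_mono_ae ?_
    filter_upwards [hg] with x hx
    simpa [hx, hT0] using hT (f x) 0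
  have h4 : dyadicSum s 0 = 0 := by simp [dyadicSum]
  rw [h4, add_zero, one_mul] at h1
  refine h1.trans ?_
  rw [mul_assoc, two_mul]
  gcongr
  exact (pow_le_pow_left₀ (by positivity) h2 2).trans (enorm_sq_le_sobolevEnergy hs0 f)

theorem abs_clamp_sub_clamp_le (a b x y : ℝ) :
    |max a (min b x) - max a (min b y)| ≤ |x - y| := by
  rw [max_comm a, max_comm a]
  refine (abs_max_sub_max_le_abs _ _ _).trans ?_
  rw [min_comm b, min_comm b]
  refine (abs_min_sub_min_le_max _ _ _ _).trans ?_
  simp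

/-- The cutoff function that vanishes for `‖x - p‖ ≤ 2⁻ᴶ`, equals `1` for `‖x - p‖ ≥ 2 · 2⁻ᴶ`, and is
affine in `‖x - p‖` in between. -/
noncomputable def pointCutoff (p : EuclideanSpace ℝ (Fin n)) (J : ℕ)
    (x : EuclideanSpace ℝ (Fin n)) : ℝ :=
  max 0 (min 1 (2 ^ J * ‖x - p‖ - 1))

theorem continuous_pointCutoff (p : EuclideanSpace ℝ (Fin n)) (J : ℕ) :
    Continuous (pointCutoff p J) := by
  unfold pointCutoff
  fun_prop

theorem pointCutoff_nonneg (p : EuclideanSpace ℝ (Fin n)) (J : ℕ) (x) : 0 ≤ pointCutoff p J x :=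
  le_max_left _ _

theorem pointCutoff_le_one (p : EuclideanSpace ℝ (Fin n)) (J : ℕ) (x) : pointCutoff p J x ≤ 1 :=
  max_le zero_le_one (min_le_left _ _)

theorem pointCutoff_eq_zero {p : EuclideanSpace ℝ (Fin n)} {J : ℕ} {x}
    (h : 2 ^ J * ‖x - p‖ ≤ 1) : pointCutoff p J x = 0 :=
  max_eq_left ((min_le_right _ _).trans (by linarith))

theorem pointCutoff_eq_one {p : EuclideanSpace ℝ (Fin n)} {J : ℕ} {x}
    (h : 2 ≤ 2 ^ J * ‖x - p‖) : pointCutoff p J x = 1 := by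
  rw [pointCutoff, min_eq_left (by linarith), max_eq_right zero_le_one]

theorem abs_pointCutoff_sub_le (p : EuclideanSpace ℝ (Fin n)) (J : ℕ) (x y) :
    |pointCutoff p J x - pointCutoff p J y| ≤ 2 ^ J * ‖x - y‖ := by
  unfold pointCutoff
  refine (abs_clamp_sub_clamp_le _ _ _ _).trans ?_
  rw [sub_sub_sub_cancel_right, ← mul_sub, abs_mul, abs_of_pos (by positivity : (0 : ℝ) < 2 ^ J)]
  gcongr
  refine (abs_norm_sub_norm_le _ _).trans_eq ?_
  rw [sub_sub_sub_cancel_right]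

theorem tendsto_pointCutoff {p x : EuclideanSpace ℝ (Fin n)} (hx : x ≠ p) :
    Tendsto (fun J => pointCutoff p J x) atTop (𝓝 1) := by
  have h1 : Tendsto (fun J : ℕ => (2 : ℝ) ^ J * ‖x - p‖) atTop atTop :=
    (tendsto_pow_atTop_atTop_of_one_lt one_lt_two).atTop_mul_const
      (norm_pos_iff.2 (sub_ne_zero.2 hx))
  refine tendsto_const_nhds.congr' ?_
  filter_upwards [h1.eventually_ge_atTop 2] with J hJ
  rw [pointCutoff_eq_one hJ]

theorem exists_dyadicDiff_pointCutoff_le (p : EuclideanSpace ℝ (Fin n)) :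
    ∃ C : ℝ≥0∞, C ≠ ∞ ∧ ∀ J k, dyadicDiff (fun x => (pointCutoff p J x : ℂ)) k ≤
      C * ENNReal.ofReal ((1 / 2 ^ J) ^ n * min 1 (4 ^ J / 4 ^ k)) := by
  set V := volume (Metric.ball (0 : EuclideanSpace ℝ (Fin n)) 1) with hV
  have hVt : V ≠ ∞ := measure_ball_lt_top.ne
  refine ⟨n * (2 * (ENNReal.ofReal (2 ^ n) * V)), by finiteness, fun J k => ?_⟩
  have key : ∀ i : Fin n, ∫⁻ x, ‖(pointCutoff p J (x + EuclideanSpace.single i (1 / 2 ^ k)) : ℂ) -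
      pointCutoff p J x‖ₑ ^ 2 ≤ 2 * (ENNReal.ofReal (2 ^ n) * V) *
        ENNReal.ofReal ((1 / 2 ^ J) ^ n * min 1 (4 ^ J / 4 ^ k)) := by
    intro i
    set e : EuclideanSpace ℝ (Fin n) := EuclideanSpace.single i (1 / 2 ^ k) with he
    have hen : ‖e‖ = 1 / 2 ^ k := by
      rw [he, PiLp.norm_single, Real.norm_of_nonneg (by positivity)]
    set A := Metric.closedBall p (2 / 2 ^ J) with hA
    set A' := (· + e) ⁻¹' A with hA'
    have hAv : volume A = ENNReal.ofReal ((2 / 2 ^ J) ^ n) * V := by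
      rw [hA, Measure.addHaar_closedBall _ _ (by positivity)]
      simp [hV]
    have hA'v : volume A' = volume A :=
      (measurePreserving_add_right volume e).measure_preimage
        measurableSet_closedBall.nullMeasurableSet
    have hnot : ∀ x, x ∉ A → pointCutoff p J x = 1 := by
      intro x hx
      rw [hA, Metric.mem_closedBall, not_le, dist_eq_norm, div_lt_iff₀ (by positivity)] at hx
      exact pointCutoff_eq_one (by linarith)
    have hpt : ∀ x, ‖(pointCutoff p J (x + e) : ℂ) - pointCutoff p J x‖ₑ ^ 2 ≤
        (A ∪ A').indicator (fun _ => ENNReal.ofReal (min 1 (4 ^ J / 4 ^ k))) x := by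
      intro x
      by_cases hx : x ∈ A ∪ A'
      · rw [Set.indicator_of_mem hx, ← Complex.ofReal_sub, ← ofReal_norm, Complex.norm_real,
          ← ENNReal.ofReal_pow (norm_nonneg _)]
        apply ENNReal.ofReal_le_ofReal
        rw [Real.norm_eq_abs, sq_abs]
        refine le_min ?_ ?_
        · have h1 := pointCutoff_nonneg p J (x + e)
          have h2 := pointCutoff_nonneg p J x
          have h3 := pointCutoff_le_one p J (x + e)
          have h4 := pointCutoff_le_one p J x
          nlinarith
        · have h1 := abs_pointCutoff_sub_le p J (x + e) x
          rw [add_sub_cancel_left, hen] at h1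
          rw [← sq_abs]
          calc _ ≤ ((2 : ℝ) ^ J * (1 / 2 ^ k)) ^ 2 := by gcongr
            _ = _ := by
              rw [mul_pow, one_div_pow, ← pow_mul, ← pow_mul, mul_comm J, mul_comm k, pow_mul,
                pow_mul]
              norm_num
              ring
      · rw [Set.mem_union, not_or] at hx
        rw [hnot x hx.1, hnot (x + e) hx.2]
        simp
    calc _ ≤ ∫⁻ x, (A ∪ A').indicator (fun _ => ENNReal.ofReal (min 1 (4 ^ J / 4 ^ k))) x :=
          lintegral_mono hpt
      _ = ENNReal.ofReal (min 1 (4 ^ J / 4 ^ k)) * volume (A ∪ A') := by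
          refine lintegral_indicator_const ?_ _
          exact measurableSet_closedBall.union
            ((measurable_add_const e) measurableSet_closedBall)
      _ ≤ ENNReal.ofReal (min 1 (4 ^ J / 4 ^ k)) * (volume A + volume A) := by
          gcongr
          exact (measure_union_le _ _).trans (by rw [hA'v])
      _ = _ := by
          rw [hAv, ENNReal.ofReal_mul (by positivity), div_eq_mul_one_div (2 : ℝ), mul_pow,
            ENNReal.ofReal_mul (by positivity)]
          ring
  calc _ ≤ ∑ _i : Fin n, 2 * (ENNReal.ofReal (2 ^ n) * V) *
        ENNReal.ofReal ((1 / 2 ^ J) ^ n * min 1 (4 ^ J / 4 ^ k)) :=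
        Finset.sum_le_sum fun i _ => key i
    _ = _ := by
        rw [Finset.sum_const, Finset.card_univ, Fintype.card_fin, nsmul_eq_mul]
        ring

/-- Cutting a bounded function off near a point keeps it bounded in `H^s`, uniformly in the size of
the cutoff. -/
theorem exists_sobolevEnergy_pointCutoff_mul_le {s : ℝ} (hs0 : 0 ≤ s)
    (hns : (2 ≤ n ∧ s ≤ 1) ∨ (n = 1 ∧ s ≤ 1 / 2)) (p : EuclideanSpace ℝ (Fin n))
    {f : Lp ℂ 2 (volume : Measure (EuclideanSpace ℝ (Fin n)))} {M : ℝ}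
    (hM : ∀ᵐ x, ‖f x‖ ≤ M) (hf : sobolevEnergy s f ≠ ∞) :
    ∃ C : ℝ≥0∞, C ≠ ∞ ∧ ∀ J, ∀ g : Lp ℂ 2 (volume : Measure (EuclideanSpace ℝ (Fin n))),
      (g =ᵐ[volume] fun x => (pointCutoff p J x : ℂ) * f x) → sobolevEnergy s g ≤ C := by
  have hs1 : s ≤ 1 := by rcases hns with h | h <;> linarith [h.2]
  obtain ⟨C, hC, h⟩ := exists_sobolevEnergy_le n hs0 hs1
  obtain ⟨C₁, hC₁, h₁⟩ := exists_dyadicDiff_pointCutoff_le p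
  obtain ⟨C₂, hC₂, h₂⟩ := exists_dyadicSum_dilate_le hns
  refine ⟨C * (‖f‖ₑ ^ 2 + 2 * sobolevEnergy s f + 2 * ENNReal.ofReal M ^ 2 * C₁ * C₂),
    by finiteness, fun J g hg => ?_⟩
  have hv : ∀ x, ‖(pointCutoff p J x : ℂ)‖ ≤ 1 := fun x => by
    rw [Complex.norm_real, Real.norm_of_nonneg (pointCutoff_nonneg p J x)]
    exact pointCutoff_le_one p J x
  -- A representative of `f` that is bounded everywhere.
  set f' : EuclideanSpace ℝ (Fin n) → ℂ := {x | ‖f x‖ ≤ M}.indicator f with hf'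
  have hff' : f =ᵐ[volume] f' := by
    filter_upwards [hM] with x hx
    rw [hf', Set.indicator_of_mem (by exact hx)]
  have hM0 : 0 ≤ M := by
    obtain ⟨x, hx⟩ := hM.exists
    exact (norm_nonneg _).trans hx
  have hM' : ∀ x, ‖f' x‖ ≤ M := by
    intro x
    by_cases hx : ‖f x‖ ≤ M
    · rw [hf', Set.indicator_of_mem (by exact hx)]
      exact hx
    · rw [hf', Set.indicator_of_notMem (by exact hx), norm_zero]
      exact hM0
  have h3 := h f g 2 (fun k => (2 * ENNReal.ofReal M ^ 2 * C₁) *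
      ENNReal.ofReal ((1 / 2 ^ J) ^ n * min 1 (4 ^ J / 4 ^ k))) fun k => by
    have hg' : g =ᵐ[volume] fun x => (pointCutoff p J x : ℂ) * f' x := by
      filter_upwards [hg, hff'] with x h1 h2
      rw [h1, h2]
    rw [dyadicDiff_congr hg' k, dyadicDiff_congr hff' k]
    refine (dyadicDiff_mul_le_of_bounded hv hM'
      ((Lp.aestronglyMeasurable f).congr hff') k).trans ?_
    rw [mul_assoc _ C₁]
    gcongr
    exact h₁ J k
  have h4 : ‖g‖ₑ ≤ ‖f‖ₑ := by
    rw [Lp.enorm_def, Lp.enorm_def]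
    refine eLpNorm_mono_ae ?_
    filter_upwards [hg] with x hx
    rw [hx, norm_mul]
    exact mul_le_of_le_one_left (norm_nonneg _) (hv x)
  refine h3.trans ?_
  rw [dyadicSum_const_mul]
  gcongr
  exact h₂ J

/-- Dominated convergence in the sense of distributions. -/
theorem tendsto_distr_of_dominated {f : Lp ℂ 2 (volume : Measure (EuclideanSpace ℝ (Fin n)))}
    {G : ℕ → Lp ℂ 2 (volume : Measure (EuclideanSpace ℝ (Fin n)))}
    {v : ℕ → EuclideanSpace ℝ (Fin n) → ℂ} (hG : ∀ j, G j =ᵐ[volume] v j)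
    (hv : ∀ j, ∀ᵐ x, ‖v j x‖ ≤ ‖f x‖)
    (hlim : ∀ᵐ x, Tendsto (fun j => v j x) atTop (𝓝 (f x))) (φ : 𝓢(EuclideanSpace ℝ (Fin n), ℂ)) :
    Tendsto (fun j => (G j : 𝓢'(EuclideanSpace ℝ (Fin n), ℂ)) φ) atTop
      (𝓝 ((f : 𝓢'(EuclideanSpace ℝ (Fin n), ℂ)) φ)) := by
  simp only [Lp.toTemperedDistribution_apply]
  refine tendsto_integral_of_dominated_convergence (fun x => ‖φ x‖ * ‖f x‖) (fun j => ?_) ?_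
    (fun j => ?_) ?_
  · exact φ.continuous.aestronglyMeasurable.smul (Lp.aestronglyMeasurable _)
  · exact (SchwartzMap.memLp φ 2 volume).norm.integrable_mul (Lp.memLp f).norm
  · filter_upwards [hG j, hv j] with x h1 h2
    rw [norm_smul, h1]
    gcongr
  · filter_upwards [hlim, ae_all_iff.2 hG] with x h1 h2
    simp only [h2]
    exact h1.const_smul _

end Multiplication

/-! ### Orthogonality by localization -/

section Localization

open scoped ContDiff Manifold

variable {n : ℕ}

/-- A finite smooth partition of unity near a compact set, with compactly supported functions. -/
theorem exists_smooth_partition {ι : Type*} [Fintype ι] {K : Set (EuclideanSpace ℝ (Fin n))}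
    (hK : IsCompact K) (U : ι → Set (EuclideanSpace ℝ (Fin n))) (hU : ∀ i, IsOpen (U i))
    (hKU : K ⊆ ⋃ i, U i) :
    ∃ χ : ι → EuclideanSpace ℝ (Fin n) → ℂ, (∀ i, ContDiff ℝ ∞ (χ i)) ∧
      (∀ i, HasCompactSupport (χ i)) ∧ (∀ i, tsupport (χ i) ⊆ U i) ∧ (∀ i x, ‖χ i x‖ ≤ 1) ∧
      ∀ x ∈ K, ∑ i, χ i x = 1 := by
  obtain ⟨R, hR⟩ := hK.isBounded.subset_ball (0 : EuclideanSpace ℝ (Fin n))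
  obtain ⟨ρ, hρ⟩ := SmoothPartitionOfUnity.exists_isSubordinate 𝓘(ℝ, EuclideanSpace ℝ (Fin n))
    hK.isClosed (fun i => U i ∩ Metric.ball 0 R) (fun i => (hU i).inter Metric.isOpen_ball)
    (fun x hx => by
      obtain ⟨i, hi⟩ := Set.mem_iUnion.1 (hKU hx)
      exact Set.mem_iUnion.2 ⟨i, hi, hR hx⟩)
  have hts : ∀ i, tsupport (fun x => (ρ i x : ℂ)) ⊆ tsupport (ρ i) := fun i =>
    tsupport_comp_subset (g := Complex.ofReal) Complex.ofReal_zero (ρ i)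
  refine ⟨fun i x => (ρ i x : ℂ), fun i => ?_, fun i => ?_, fun i => ?_, fun i x => ?_,
    fun x hx => ?_⟩
  · exact Complex.ofRealCLM.contDiff.comp (ρ i).contMDiff.contDiff
  · refine Metric.isCompact_of_isClosed_isBounded (isClosed_tsupport _) ?_
    exact Metric.isBounded_ball.subset ((hts i).trans ((hρ i).trans Set.inter_subset_right))
  · exact (hts i).trans ((hρ i).trans Set.inter_subset_left)
  · rw [Complex.norm_real, Real.norm_of_nonneg (ρ.nonneg i x)]
    exact ρ.le_one i x
  · have h := ρ.sum_eq_one hx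
    rw [finsum_eq_sum_of_fintype] at h
    rw [← Complex.ofReal_sum, h, Complex.ofReal_one]

theorem exists_lipschitz_of_smooth {χ : EuclideanSpace ℝ (Fin n) → ℂ} (h1 : ContDiff ℝ ∞ χ)
    (h2 : HasCompactSupport χ) : ∃ L : ℝ, ∀ x y, ‖χ x - χ y‖ ≤ L * ‖x - y‖ := by
  obtain ⟨C, hC⟩ := ContDiff.lipschitzWith_of_hasCompactSupport h2 h1 (by simp)
  exact ⟨C, fun x y => by simpa [dist_eq_norm] using hC.dist_le_mul x y⟩

theorem OrthogonalTo.of_sobolevEnergy_ne_top {s : ℝ} (hs : 0 ≤ s)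
    {b f : Lp ℂ 2 (volume : Measure (EuclideanSpace ℝ (Fin n)))}
    (h : sobolevEnergy s f ≠ ⊤ → OrthogonalTo s b f) : OrthogonalTo s b f := by
  intro u hu
  refine h ?_ u hu
  rw [← enorm_toL2_sq hs hu]
  finiteness

theorem orthogonalTo_toLp {s : ℝ} {b : Lp ℂ 2 (volume : Measure (EuclideanSpace ℝ (Fin n)))}
    {φ : 𝓢(EuclideanSpace ℝ (Fin n), ℂ)}
    (h : TemperedDistribution.besselPotential (EuclideanSpace ℝ (Fin n)) ℂ s b φ = 0) :
    OrthogonalTo s b (φ.toLp 2) := by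
  intro u hu
  have e : u = SobolevH.ofSchwartz s φ := by
    apply SobolevH.toDistr_injective
    rw [hu, Lp.toTemperedDistribution_toLp_eq]
    rfl
  have h2 : ∫ x, SobolevH.toL2 u x * b x = ∫ x, b x *
      ((besselSchwartz s φ).toLp 2 volume : Lp ℂ 2 (volume : Measure (EuclideanSpace ℝ (Fin n)))) x := by
    rw [e, toL2_ofSchwartz]
    exact integral_congr_ae (ae_of_all _ fun x => mul_comm _ _)
  rw [h2, integral_mul_toLp, ← besselPotential_apply, h]

theorem OrthogonalTo.sum {s : ℝ} (hs : 0 ≤ s) {ι : Type*} [Fintype ι]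
    {b : Lp ℂ 2 (volume : Measure (EuclideanSpace ℝ (Fin n)))}
    {f : ι → Lp ℂ 2 (volume : Measure (EuclideanSpace ℝ (Fin n)))}
    (hf : ∀ i, sobolevEnergy s (f i) ≠ ⊤) (h : ∀ i, OrthogonalTo s b (f i)) :
    OrthogonalTo s b (∑ i, f i) := by
  intro u hu
  choose v hv using fun i => exists_sobolevH_of_energy_ne_top hs (hf i)
  have e : u = ∑ i, v i := by
    apply SobolevH.toDistr_injective
    rw [hu, map_sum, ← Lp.toTemperedDistributionCLM_apply, map_sum]
    simp only [hv, Lp.toTemperedDistributionCLM_apply]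
  rw [e, map_sum, integral_mul_eq_inner, inner_sum]
  refine Finset.sum_eq_zero fun i _ => ?_
  rw [← integral_mul_eq_inner]
  exact h i _ (hv i)

theorem continuous_toTemperedDistribution_apply (φ : 𝓢(EuclideanSpace ℝ (Fin n), ℂ)) :
    Continuous fun g : Lp ℂ 2 (volume : Measure (EuclideanSpace ℝ (Fin n))) =>
      (g : 𝓢'(EuclideanSpace ℝ (Fin n), ℂ)) φ := by
  simp only [← integral_mul_toLp, integral_mul_eq_inner]
  fun_prop

/-- The operators `J_s` and the multiplication with `χ` are their own transposes. -/
theorem toTemperedDistribution_smulLeftCLM_besselSchwartz (s : ℝ)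
    {χ : EuclideanSpace ℝ (Fin n) → ℂ} (hχ : Function.HasTemperateGrowth χ)
    (ψ η : 𝓢(EuclideanSpace ℝ (Fin n), ℂ)) :
    (((SchwartzMap.smulLeftCLM ℂ χ (besselSchwartz s ψ)).toLp 2 :
        Lp ℂ 2 (volume : Measure (EuclideanSpace ℝ (Fin n)))) :
          𝓢'(EuclideanSpace ℝ (Fin n), ℂ)) η =
      ((ψ.toLp 2 : Lp ℂ 2 (volume : Measure (EuclideanSpace ℝ (Fin n)))) :
        𝓢'(EuclideanSpace ℝ (Fin n), ℂ)) (besselSchwartz s (SchwartzMap.smulLeftCLM ℂ χ η)) := by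
  have h9 := SobolevH.toL2_spec (SobolevH.ofSchwartz s ψ)
  rw [toL2_ofSchwartz] at h9
  have h10 : SobolevH.toDistr (SobolevH.ofSchwartz s ψ) =
      ((ψ.toLp 2 : Lp ℂ 2 (volume : Measure (EuclideanSpace ℝ (Fin n)))) :
        𝓢'(EuclideanSpace ℝ (Fin n), ℂ)) := (Lp.toTemperedDistribution_toLp_eq _).symm
  rw [← besselPotential_apply, ← h10, h9, Lp.toTemperedDistribution_apply,
    Lp.toTemperedDistribution_apply]
  refine integral_congr_ae ?_
  filter_upwards [SchwartzMap.coeFn_toLp (SchwartzMap.smulLeftCLM ℂ χ (besselSchwartz s ψ)) 2 volume,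
    SchwartzMap.coeFn_toLp (besselSchwartz s ψ) 2 volume] with x hx1 hx2
  rw [hx1, hx2, SchwartzMap.smulLeftCLM_apply_apply hχ, SchwartzMap.smulLeftCLM_apply_apply hχ]
  simp only [smul_eq_mul]
  ring

theorem exists_smooth_cutoff {G K : Set (EuclideanSpace ℝ (Fin n))} (hK : IsCompact K)
    (hG : IsOpen G) (hKG : K ⊆ G) :
    ∃ χ : EuclideanSpace ℝ (Fin n) → ℂ, ContDiff ℝ ∞ χ ∧ HasCompactSupport χ ∧ tsupport χ ⊆ G ∧
      (∀ x, ‖χ x‖ ≤ 1) ∧ ∀ x ∈ K, χ x = 1 := by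
  obtain ⟨χ, h1, h2, h3, h4, h5⟩ := exists_smooth_partition hK (fun _ : Unit => G) (fun _ => hG)
    (fun x hx => Set.mem_iUnion.2 ⟨(), hKG hx⟩)
  exact ⟨χ (), h1 (), h2 (), h3 (), h4 (), fun x hx => by simpa using h5 x hx⟩

theorem sobolevEnergy_toLp_besselSchwartz_neg {s : ℝ} (hs : 0 ≤ s)
    (ψ : 𝓢(EuclideanSpace ℝ (Fin n), ℂ)) :
    sobolevEnergy s ((besselSchwartz (-s) ψ).toLp 2) = ‖ψ.toLp 2 volume‖ₑ ^ 2 := by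
  rw [← enorm_toL2_sq hs (u := SobolevH.ofSchwartz s (besselSchwartz (-s) ψ))
    (Lp.toTemperedDistribution_toLp_eq _).symm, toL2_ofSchwartz,
    besselSchwartz_besselSchwartz, add_neg_cancel, besselSchwartz_zero]

theorem toTemperedDistribution_apply_eq_toL2_apply {s : ℝ}
    {f : Lp ℂ 2 (volume : Measure (EuclideanSpace ℝ (Fin n)))} {u : SobolevH n s}
    (hu : SobolevH.toDistr u = f) {χ : EuclideanSpace ℝ (Fin n) → ℂ}
    (hχ : Function.HasTemperateGrowth χ) (hf : ∀ᵐ x, χ x * f x = f x)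
    (η : 𝓢(EuclideanSpace ℝ (Fin n), ℂ)) :
    (f : 𝓢'(EuclideanSpace ℝ (Fin n), ℂ)) η =
      (SobolevH.toL2 u : 𝓢'(EuclideanSpace ℝ (Fin n), ℂ))
        (besselSchwartz (-s) (SchwartzMap.smulLeftCLM ℂ χ η)) := by
  rw [toL2_apply_schwartz hu, besselSchwartz_besselSchwartz, add_neg_cancel,
    besselSchwartz_zero, Lp.toTemperedDistribution_apply, Lp.toTemperedDistribution_apply]
  refine integral_congr_ae ?_
  filter_upwards [hf] with x hx
  rw [SchwartzMap.smulLeftCLM_apply_apply hχ]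
  simp only [smul_eq_mul]
  rw [mul_comm (χ x), mul_assoc, hx]

theorem exists_seq_schwartz_tendsto (g : Lp ℂ 2 (volume : Measure (EuclideanSpace ℝ (Fin n)))) :
    ∃ ψ : ℕ → 𝓢(EuclideanSpace ℝ (Fin n), ℂ),
      Tendsto (fun j => (ψ j).toLp 2 volume) atTop (𝓝 g) := by
  obtain ⟨ψ', hψ', hlim⟩ := mem_closure_iff_seq_limit.1 ((SchwartzMap.denseRange_toLpCLM (p := 2)
    (F := ℂ) (E := EuclideanSpace ℝ (Fin n)) (μ := volume) ENNReal.ofNat_ne_top) g)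
  choose ψ hψ using hψ'
  exact ⟨ψ, hlim.congr fun j => (hψ j).symm⟩

/-- A function in `H^s` with compact support in an open set `G` is orthogonal to every distribution
in `H^{-s}` that vanishes on `G`: it is the limit of smooth functions, cut off to `G`. -/
theorem OrthogonalTo.of_compact_subset_open {s : ℝ} (hs0 : 0 ≤ s) (hs1 : s ≤ 1)
    {b f : Lp ℂ 2 (volume : Measure (EuclideanSpace ℝ (Fin n)))}
    {G K : Set (EuclideanSpace ℝ (Fin n))} (hG : IsOpen G)
    (hb : ∀ φ : 𝓢(EuclideanSpace ℝ (Fin n), ℂ), HasCompactSupport φ → tsupport φ ⊆ G →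
      TemperedDistribution.besselPotential (EuclideanSpace ℝ (Fin n)) ℂ s b φ = 0)
    (hK : IsCompact K) (hKG : K ⊆ G) (hf : ∀ᵐ x, x ∉ K → f x = 0) : OrthogonalTo s b f := by
  intro u hu
  obtain ⟨χ, h1, h2, h3, h4, h5⟩ := exists_smooth_cutoff hK hG hKG
  have hχ : Function.HasTemperateGrowth χ := h2.hasTemperateGrowth h1
  have hχf : ∀ᵐ x, χ x * f x = f x := by
    filter_upwards [hf] with x hx
    by_cases hxK : x ∈ K
    · rw [h5 x hxK, one_mul]
    · rw [hx hxK, mul_zero]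
  obtain ⟨L, hL⟩ := exists_lipschitz_of_smooth h1 h2
  obtain ⟨C, hC, hmul⟩ := exists_sobolevEnergy_mul_le n hs0 hs1 L
  obtain ⟨ψ, hψ⟩ := exists_seq_schwartz_tendsto (SobolevH.toL2 u)
  obtain ⟨D, hD⟩ := hψ.norm.bddAbove_range
  have hE : ∀ j, sobolevEnergy s ((SchwartzMap.smulLeftCLM ℂ χ
      (besselSchwartz (-s) (ψ j))).toLp 2) ≤ C * ENNReal.ofReal D ^ 2 := by
    intro j
    refine (hmul χ h4 hL ((besselSchwartz (-s) (ψ j)).toLp 2) _ ?_).trans ?_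
    · filter_upwards [SchwartzMap.coeFn_toLp
          (SchwartzMap.smulLeftCLM ℂ χ (besselSchwartz (-s) (ψ j))) 2 volume,
        SchwartzMap.coeFn_toLp (besselSchwartz (-s) (ψ j)) 2 volume] with x hx1 hx2
      rw [hx1, hx2, SchwartzMap.smulLeftCLM_apply_apply hχ, smul_eq_mul]
    · rw [sobolevEnergy_toLp_besselSchwartz_neg hs0]
      gcongr
      rw [← ofReal_norm]
      exact ENNReal.ofReal_le_ofReal (hD ⟨j, rfl⟩)
  have hO : ∀ j, OrthogonalTo s b ((SchwartzMap.smulLeftCLM ℂ χ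
      (besselSchwartz (-s) (ψ j))).toLp 2) := by
    intro j
    refine orthogonalTo_toLp (hb _ ?_ ?_)
    · rw [SchwartzMap.smulLeftCLM_apply hχ]
      exact h2.smul_right
    · rw [SchwartzMap.smulLeftCLM_apply hχ]
      exact (tsupport_smul_subset_left _ _).trans h3
  refine OrthogonalTo.of_tendsto hs0 (by finiteness) hE (fun η => ?_) hO u hu
  rw [toTemperedDistribution_apply_eq_toL2_apply hu hχ hχf]
  simp only [toTemperedDistribution_smulLeftCLM_besselSchwartz (-s) hχ]
  exact ((continuous_toTemperedDistribution_apply _).tendsto _).comp hψ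

theorem sobolevEnergy_translateLp (s : ℝ) (h : EuclideanSpace ℝ (Fin n))
    (f : Lp ℂ 2 (volume : Measure (EuclideanSpace ℝ (Fin n)))) :
    sobolevEnergy s (translateLp h f) = sobolevEnergy s f := by
  unfold sobolevEnergy
  refine lintegral_congr_ae ?_
  filter_upwards [fourier_translateLp h f] with ξ hξ
  have e : ‖Complex.exp ((2 * Real.pi * inner ℝ h ξ : ℝ) * Complex.I)‖ₑ = 1 := by
    rw [← ofReal_norm, Complex.norm_exp_ofReal_mul_I, ENNReal.ofReal_one]
  rw [hξ, enorm_mul, e, one_mul]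

/-- A function in `H^s` whose compact support is moved into the open set `G` by all small positive
multiples of a vector is orthogonal to the distributions in `H^{-s}` that vanish on `G`. -/
theorem OrthogonalTo.of_push {s : ℝ} (hs0 : 0 ≤ s) (hs1 : s ≤ 1)
    {b f : Lp ℂ 2 (volume : Measure (EuclideanSpace ℝ (Fin n)))}
    {G K : Set (EuclideanSpace ℝ (Fin n))} (hG : IsOpen G)
    (hb : ∀ φ : 𝓢(EuclideanSpace ℝ (Fin n), ℂ), HasCompactSupport φ → tsupport φ ⊆ G →
      TemperedDistribution.besselPotential (EuclideanSpace ℝ (Fin n)) ℂ s b φ = 0)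
    (hK : IsCompact K) {v : EuclideanSpace ℝ (Fin n)} {r : ℝ} (hr : 0 < r)
    (hpush : ∀ h, 0 < h → h < r → ∀ y ∈ K, y + h • v ∈ G)
    (hf : ∀ᵐ x, x ∉ K → f x = 0) : OrthogonalTo s b f := by
  refine OrthogonalTo.of_sobolevEnergy_ne_top hs0 fun hE => ?_
  set t : ℕ → ℝ := fun j => r / (j + 2) with ht
  have ht0 : ∀ j, 0 < t j := fun j => by positivity
  have htr : ∀ j, t j < r := fun j => by
    rw [ht, div_lt_iff₀ (by positivity)]
    nlinarith [(Nat.cast_nonneg j : (0 : ℝ) ≤ j)]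
  have htlim : Tendsto t atTop (𝓝 0) := by
    have h1 := (tendsto_const_div_atTop_nhds_zero_nat r).comp (tendsto_add_atTop_nat 2)
    refine h1.congr fun j => ?_
    simp [ht]
  have hlim : Tendsto (fun j => -(t j • v)) atTop (𝓝 0) := by
    simpa using (htlim.smul_const v).neg
  have hlim2 := tendsto_translateLp hlim f
  refine OrthogonalTo.of_tendsto hs0 hE (f := fun j => translateLp (-(t j • v)) f)
    (fun j => (sobolevEnergy_translateLp _ _ _).le) (fun φ => ?_) (fun j => ?_)
  · exact ((continuous_toTemperedDistribution_apply φ).tendsto _).comp hlim2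
  · refine OrthogonalTo.of_compact_subset_open hs0 hs1 hG hb
      (hK.image (continuous_add_const (t j • v))) ?_ ?_
    · rintro _ ⟨y, hy, rfl⟩
      exact hpush _ (ht0 j) (htr j) y hy
    · filter_upwards [coeFn_translateLp (-(t j • v)) f,
        (measurePreserving_add_right volume (-(t j • v))).quasiMeasurePreserving.ae hf]
        with x hx1 hx2 hx3
      rw [hx1]
      refine hx2 fun hx4 => hx3 ⟨_, hx4, ?_⟩
      simp

/-- The open set `G` can be reached from the points of `F` near `x` by small translations in a fixed
direction. The direction may be zero, so that this holds if `x` is an interior point of `G` or has a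
neighborhood that does not meet `F`. -/
def CanPush (F G : Set (EuclideanSpace ℝ (Fin n))) (x : EuclideanSpace ℝ (Fin n)) : Prop :=
  ∃ V ∈ 𝓝 x, ∃ v : EuclideanSpace ℝ (Fin n), ∃ r : ℝ, 0 < r ∧
    ∀ h, 0 < h → h < r → ∀ y ∈ V ∩ F, y + h • v ∈ G

/-- A function with compact support in `F` is cut, by a partition of unity, into pieces that can be
pushed into `G` in a single direction each. -/
theorem OrthogonalTo.of_canPush {s : ℝ} (hs0 : 0 ≤ s) (hs1 : s ≤ 1)
    {b f : Lp ℂ 2 (volume : Measure (EuclideanSpace ℝ (Fin n)))}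
    {F G K : Set (EuclideanSpace ℝ (Fin n))} (hG : IsOpen G)
    (hb : ∀ φ : 𝓢(EuclideanSpace ℝ (Fin n), ℂ), HasCompactSupport φ → tsupport φ ⊆ G →
      TemperedDistribution.besselPotential (EuclideanSpace ℝ (Fin n)) ℂ s b φ = 0)
    (hK : IsCompact K) (hKF : K ⊆ F) (hpush : ∀ x ∈ K, CanPush F G x)
    (hf : ∀ᵐ x, x ∉ K → f x = 0) : OrthogonalTo s b f := by
  refine OrthogonalTo.of_sobolevEnergy_ne_top hs0 fun hE => ?_
  choose! V hV v r hr hp using hpush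
  obtain ⟨t, htK, ht⟩ := hK.elim_nhds_subcover (fun x => interior (V x))
    fun x hx => interior_mem_nhds.2 (hV x hx)
  obtain ⟨χ, h1, h2, h3, h4, h5⟩ := exists_smooth_partition hK
    (fun i : t => interior (V i)) (fun i => isOpen_interior) (fun x hx => by
      obtain ⟨i, hi, hxi⟩ := Set.mem_iUnion₂.1 (ht hx)
      exact Set.mem_iUnion.2 ⟨⟨i, hi⟩, hxi⟩)
  have hmem : ∀ i, ∃ g : Lp ℂ 2 (volume : Measure (EuclideanSpace ℝ (Fin n))),
      (g =ᵐ[volume] fun x => χ i x * f x) ∧ ‖g‖ₑ ≤ ‖f‖ₑ := fun i => by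
    refine exists_lp_ae_eq_of_norm_le f
      ((h1 i).continuous.aestronglyMeasurable.mul (Lp.aestronglyMeasurable f))
      (ae_of_all _ fun x => ?_)
    rw [norm_mul]
    exact mul_le_of_le_one_left (norm_nonneg _) (h4 i x)
  choose g hg _ using hmem
  have hsum : f = ∑ i, g i := by
    refine Lp.ext ?_
    have h6 := Lp.coeFn_finsetSum Finset.univ g
    filter_upwards [h6, hf, ae_all_iff.2 hg] with x hx1 hx2 hx3
    rw [hx1, Finset.sum_apply]
    simp only [hx3]
    rw [← Finset.sum_mul]
    by_cases hxK : x ∈ K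
    · rw [h5 x hxK, one_mul]
    · rw [hx2 hxK, mul_zero]
  rw [hsum]
  refine OrthogonalTo.sum hs0 (fun i => ?_) (fun i => ?_)
  · obtain ⟨L, hL⟩ := exists_lipschitz_of_smooth (h1 i) (h2 i)
    obtain ⟨C, hC, hmul⟩ := exists_sobolevEnergy_mul_le n hs0 hs1 L
    exact ne_top_of_le_ne_top (by finiteness) (hmul (χ i) (h4 i) hL f _ (hg i))
  · refine OrthogonalTo.of_push hs0 hs1 hG hb (hK.inter_right (isClosed_tsupport (χ i)))
      (hr i (htK i i.2)) (v := v i) (fun h hh0 hhr y hy => ?_) ?_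
    · exact hp i (htK i i.2) h hh0 hhr y ⟨interior_subset (h3 i hy.2), hKF hy.1⟩
    · filter_upwards [hf, hg i] with x hx1 hx2 hx3
      rw [hx2]
      by_cases hxK : x ∈ K
      · rw [image_eq_zero_of_notMem_tsupport fun h => hx3 ⟨hxK, h⟩, zero_mul]
      · rw [hx1 hxK, mul_zero]

end Localization

/-! ### Removal of exceptional points -/

section Exceptional

variable {n : ℕ}

/-- Finitely many points can be removed: bounded functions in `H^s` are approximated by functions
vanishing near a given point, with bounded energies. -/
theorem OrthogonalTo.of_finite_inter {s : ℝ} (hs0 : 0 ≤ s)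
    (hns : (2 ≤ n ∧ s ≤ 1) ∨ (n = 1 ∧ s ≤ 1 / 2))
    {b : Lp ℂ 2 (volume : Measure (EuclideanSpace ℝ (Fin n)))} {F S : Set (EuclideanSpace ℝ (Fin n))}
    {M : ℝ} (h : ∀ K, IsCompact K → K ⊆ F → K ∩ S = ∅ →
      ∀ f : Lp ℂ 2 (volume : Measure (EuclideanSpace ℝ (Fin n))), (∀ᵐ x, ‖f x‖ ≤ M) →
        (∀ᵐ x, x ∉ K → f x = 0) → OrthogonalTo s b f)
    {K : Set (EuclideanSpace ℝ (Fin n))} (hK : IsCompact K) (hKF : K ⊆ F) (hKS : (K ∩ S).Finite)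
    {f : Lp ℂ 2 (volume : Measure (EuclideanSpace ℝ (Fin n)))} (hM : ∀ᵐ x, ‖f x‖ ≤ M)
    (hf : ∀ᵐ x, x ∉ K → f x = 0) : OrthogonalTo s b f := by
  obtain ⟨m, hm⟩ : ∃ m, (K ∩ S).ncard < m := ⟨_, Nat.lt_succ_self _⟩
  induction m generalizing K f with
  | zero => omega
  | succ m ih =>
    rcases (K ∩ S).eq_empty_or_nonempty with he | ⟨p, hp⟩
    · exact h K hK hKF he f hM hf
    refine OrthogonalTo.of_sobolevEnergy_ne_top hs0 fun hE => ?_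
    obtain ⟨C, hC, hbd⟩ := exists_sobolevEnergy_pointCutoff_mul_le hs0 hns p hM hE
    have hle : ∀ J x, ‖(pointCutoff p J x : ℂ) * f x‖ ≤ ‖f x‖ := fun J x => by
      rw [norm_mul, Complex.norm_real, Real.norm_of_nonneg (pointCutoff_nonneg p J x)]
      exact mul_le_of_le_one_left (norm_nonneg _) (pointCutoff_le_one p J x)
    choose g hg _ using fun J => exists_lp_ae_eq_of_norm_le f
      ((Complex.continuous_ofReal.comp (continuous_pointCutoff p J)).aestronglyMeasurable.mul
        (Lp.aestronglyMeasurable f)) (ae_of_all _ (hle J))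
    have hnt : Nontrivial (EuclideanSpace ℝ (Fin n)) := by
      have : Nonempty (Fin n) := ⟨⟨0, by omega⟩⟩
      infer_instance
    have hae : ∀ᵐ x : EuclideanSpace ℝ (Fin n), x ≠ p := by
      simp [ae_iff]
    refine OrthogonalTo.of_tendsto hs0 hC (fun J => hbd J (g J) (hg J))
      (tendsto_distr_of_dominated hg (fun J => ae_of_all _ (hle J)) ?_) (fun J => ?_)
    · filter_upwards [hae] with x hx
      simpa using ((Complex.continuous_ofReal.tendsto _).comp (tendsto_pointCutoff hx)).mul_const
        (f x)
    · have hcl : IsClosed {x | 1 ≤ 2 ^ J * ‖x - p‖} :=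
        isClosed_le continuous_const (by fun_prop)
      have hsub : K ∩ {x | 1 ≤ 2 ^ J * ‖x - p‖} ∩ S ⊆ (K ∩ S) \ {p} := by
        rintro x ⟨⟨h1, h2⟩, h3⟩
        refine ⟨⟨h1, h3⟩, ?_⟩
        rintro rfl
        norm_num at h2
      have hlt := Set.ncard_sdiff_singleton_lt_of_mem hp hKS
      refine ih (hK.inter_right hcl) (Set.inter_subset_left.trans hKF)
        ((hKS.subset Set.sdiff_subset).subset hsub) ?_ ?_ ?_
      · filter_upwards [hg J, hM] with x h1 h2
        rw [h1]
        exact (hle J x).trans h2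
      · filter_upwards [hg J, hf] with x h1 h2 h3
        rw [h1]
        by_cases hxK : x ∈ K
        · have h4 : 2 ^ J * ‖x - p‖ ≤ 1 := by
            by_contra h5
            exact h3 ⟨hxK, (not_le.1 h5).le⟩
          rw [Pi.mul_apply, Function.comp_apply, pointCutoff_eq_zero h4, Complex.ofReal_zero,
            zero_mul]
        · rw [Pi.mul_apply, h2 hxK, mul_zero]
      · have := Set.ncard_le_ncard hsub (hKS.subset Set.sdiff_subset)
        omega

/-- Functions bounded by a constant suffice, by truncation of the real and imaginary parts. -/
theorem OrthogonalTo.of_truncate {s : ℝ} (hs0 : 0 ≤ s) (hs1 : s ≤ 1)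
    {b f : Lp ℂ 2 (volume : Measure (EuclideanSpace ℝ (Fin n)))}
    (h : ∀ (M : ℝ) (g : Lp ℂ 2 (volume : Measure (EuclideanSpace ℝ (Fin n)))),
      (∀ᵐ x, ‖g x‖ ≤ M) → (∀ᵐ x, f x = 0 → g x = 0) → OrthogonalTo s b g) :
    OrthogonalTo s b f := by
  refine OrthogonalTo.of_sobolevEnergy_ne_top hs0 fun hE => ?_
  obtain ⟨C, hC, hbd⟩ := exists_sobolevEnergy_comp_le n hs0 hs1
  set c : ℕ → ℝ → ℝ := fun j x => max (-j) (min j x) with hc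
  have hc0 : ∀ j, c j 0 = 0 := fun j => by simp [hc]
  have hcl : ∀ j x y, |c j x - c j y| ≤ |x - y| := fun j x y => abs_clamp_sub_clamp_le _ _ _ _
  have hcb : ∀ j x, |c j x| ≤ j := fun j x => by
    rw [abs_le]
    refine ⟨le_max_left _ _, max_le ?_ (min_le_left _ _)⟩
    linarith [(Nat.cast_nonneg j : (0 : ℝ) ≤ j)]
  have hce : ∀ (j : ℕ) (x : ℝ), |x| ≤ j → c j x = x := fun j x hx => by
    rw [abs_le] at hx
    simp only [hc]
    rw [min_eq_right hx.2, max_eq_right hx.1]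
  set T : ℕ → ℂ → ℂ := fun j z => ⟨c j z.re, c j z.im⟩ with hT
  have hT0 : ∀ j, T j 0 = 0 := fun j => by simp [hT, hc0, Complex.ext_iff]
  have hTl : ∀ j z w, ‖T j z - T j w‖ ≤ ‖z - w‖ := fun j z w => by
    rw [Complex.norm_def, Complex.norm_def]
    refine Real.sqrt_le_sqrt ?_
    simp only [Complex.normSq_apply, hT, Complex.sub_re, Complex.sub_im]
    have h1 := sq_le_sq.2 (hcl j z.re w.re)
    have h2 := sq_le_sq.2 (hcl j z.im w.im)
    nlinarith
  have hTle : ∀ j z, ‖T j z‖ ≤ ‖z‖ := fun j z => by simpa [hT0] using hTl j z 0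
  have hTc : ∀ j, Continuous (T j) := fun j =>
    (LipschitzWith.of_dist_le_mul (K := 1) fun z w => by
      simpa [dist_eq_norm] using hTl j z w).continuous
  choose g hg _ using fun j => exists_lp_ae_eq_of_norm_le f
    ((hTc j).comp_aestronglyMeasurable (Lp.aestronglyMeasurable f))
    (ae_of_all _ fun x => hTle j (f x))
  refine OrthogonalTo.of_tendsto hs0 (C := C * sobolevEnergy s f) (by finiteness)
    (fun j => hbd (T j) (hTl j) (hT0 j) f (g j) (hg j))
    (tendsto_distr_of_dominated hg (fun j => ae_of_all _ fun x => hTle j (f x))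
      (ae_of_all _ fun x => ?_)) (fun j => h (j + j) (g j) ?_ ?_)
  · refine tendsto_const_nhds.congr' ?_
    obtain ⟨N, hN⟩ := exists_nat_ge ‖f x‖
    filter_upwards [eventually_ge_atTop N] with j hj
    have hj' : ‖f x‖ ≤ j := hN.trans (by exact_mod_cast hj)
    apply Complex.ext
    · exact (hce j _ ((Complex.abs_re_le_norm _).trans hj')).symm
    · exact (hce j _ ((Complex.abs_im_le_norm _).trans hj')).symm
  · filter_upwards [hg j] with x hx
    rw [hx]
    exact (Complex.norm_le_abs_re_add_abs_im _).trans (add_le_add (hcb j _) (hcb j _))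
  · filter_upwards [hg j] with x hx hx0
    rw [hx, hx0, hT0]

/-- Functions with bounded support suffice, by multiplication with Lipschitz cutoff functions. -/
theorem OrthogonalTo.of_bounded_support {s : ℝ} (hs0 : 0 ≤ s) (hs1 : s ≤ 1)
    {b f : Lp ℂ 2 (volume : Measure (EuclideanSpace ℝ (Fin n)))}
    (h : ∀ (R : ℝ) (g : Lp ℂ 2 (volume : Measure (EuclideanSpace ℝ (Fin n)))),
      (∀ᵐ x, ‖g x‖ ≤ ‖f x‖) → (∀ᵐ x, x ∉ Metric.closedBall 0 R → g x = 0) → OrthogonalTo s b g) :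
    OrthogonalTo s b f := by
  refine OrthogonalTo.of_sobolevEnergy_ne_top hs0 fun hE => ?_
  set v : ℕ → EuclideanSpace ℝ (Fin n) → ℝ := fun R x => max 0 (min 1 (R - ‖x‖)) with hv
  have hv0 : ∀ R x, 0 ≤ v R x := fun R x => le_max_left _ _
  have hv1 : ∀ R x, v R x ≤ 1 := fun R x => max_le zero_le_one (min_le_left _ _)
  have hvn : ∀ R x, ‖(v R x : ℂ)‖ ≤ 1 := fun R x => by
    rw [Complex.norm_real, Real.norm_of_nonneg (hv0 R x)]
    exact hv1 R x
  have hvl : ∀ R x y, ‖(v R x : ℂ) - v R y‖ ≤ 1 * ‖x - y‖ := fun R x y => by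
    rw [← Complex.ofReal_sub, Complex.norm_real, Real.norm_eq_abs, one_mul]
    refine (abs_clamp_sub_clamp_le _ _ _ _).trans ?_
    rw [sub_sub_sub_cancel_left, abs_sub_comm]
    exact abs_norm_sub_norm_le _ _
  have hvc : ∀ R, Continuous (v R) := fun R => by
    simp only [hv]
    fun_prop
  have hle : ∀ R x, ‖(v R x : ℂ) * f x‖ ≤ ‖f x‖ := fun R x => by
    rw [norm_mul]
    exact mul_le_of_le_one_left (norm_nonneg _) (hvn R x)
  choose g hg _ using fun R => exists_lp_ae_eq_of_norm_le f
    ((Complex.continuous_ofReal.comp (hvc R)).aestronglyMeasurable.mul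
      (Lp.aestronglyMeasurable f)) (ae_of_all _ (hle R))
  obtain ⟨C, hC, hmul⟩ := exists_sobolevEnergy_mul_le n hs0 hs1 1
  refine OrthogonalTo.of_tendsto hs0 (C := C * sobolevEnergy s f) (by finiteness)
    (fun R => hmul (fun x => (v R x : ℂ)) (hvn R) (hvl R) f (g R) (hg R))
    (tendsto_distr_of_dominated hg (fun R => ae_of_all _ (hle R)) (ae_of_all _ fun x => ?_))
    (fun R => h R (g R) ?_ ?_)
  · refine tendsto_const_nhds.congr' ?_
    obtain ⟨N, hN⟩ := exists_nat_ge (‖x‖ + 1)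
    filter_upwards [eventually_ge_atTop N] with R hR
    have hR' : ‖x‖ + 1 ≤ R := hN.trans (by exact_mod_cast hR)
    have h1 : v R x = 1 := by
      simp only [hv]
      rw [min_eq_left (by linarith), max_eq_right zero_le_one]
    simp [h1]
  · filter_upwards [hg R] with x hx
    rw [hx]
    exact hle R x
  · filter_upwards [hg R] with x hx hxR
    have h1 : v R x = 0 := by
      rw [mem_closedBall_zero_iff, not_le] at hxR
      simp only [hv]
      exact max_eq_left ((min_le_right _ _).trans (by linarith))
    simp [hx, h1]

/-- Let `b ∈ L²` be such that `J_s b` vanishes on the open set `G`. If `G` can be reached by small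
translations from the points of the closed set `F` outside of `P`, where `P` has only finitely many
limit points in each compact subset of `F`, then `b` is orthogonal to the elements of `H^s` that
vanish outside of `F`. -/
theorem OrthogonalTo.of_exceptional {s : ℝ} (hs0 : 0 ≤ s)
    (hns : (2 ≤ n ∧ s ≤ 1) ∨ (n = 1 ∧ s ≤ 1 / 2))
    {b f : Lp ℂ 2 (volume : Measure (EuclideanSpace ℝ (Fin n)))}
    {F G P : Set (EuclideanSpace ℝ (Fin n))} (hF : IsClosed F) (hG : IsOpen G)
    (hP : ∀ K, IsCompact K → K ⊆ F → (K ∩ derivedSet P).Finite)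
    (hpush : ∀ x ∈ F \ P, CanPush F G x)
    (hb : ∀ φ : 𝓢(EuclideanSpace ℝ (Fin n), ℂ), HasCompactSupport φ → tsupport φ ⊆ G →
      TemperedDistribution.besselPotential (EuclideanSpace ℝ (Fin n)) ℂ s b φ = 0)
    (hf : ∀ᵐ x, x ∉ F → f x = 0) : OrthogonalTo s b f := by
  have hs1 : s ≤ 1 := by rcases hns with h | h <;> linarith [h.2]
  refine OrthogonalTo.of_truncate hs0 hs1 fun M g hgM hg =>
    OrthogonalTo.of_bounded_support hs0 hs1 fun R k hkg hk => ?_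
  refine OrthogonalTo.of_finite_inter hs0 hns (F := F) (S := derivedSet P) (M := M) ?_
    ((isCompact_closedBall (0 : EuclideanSpace ℝ (Fin n)) R).inter_left hF) Set.inter_subset_left
    (hP _ ((isCompact_closedBall _ R).inter_left hF) Set.inter_subset_left) ?_ ?_
  · intro K hK hKF hKP f hM hf
    refine OrthogonalTo.of_finite_inter hs0 hns (F := F) (S := P) (M := M) ?_ hK hKF ?_ hM hf
    · intro K hK hKF hKP f hM hf
      refine OrthogonalTo.of_canPush hs0 hs1 hG hb hK hKF (fun x hx => hpush x ⟨hKF hx, ?_⟩) hf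
      intro hxP
      exact (hKP.subset ⟨hx, hxP⟩ : x ∈ (∅ : Set _))
    · by_contra hinf
      obtain ⟨x, hxK, hx⟩ := Set.Infinite.exists_accPt_of_subset_isCompact hinf hK
        Set.inter_subset_left
      have : x ∈ K ∩ derivedSet P := ⟨hxK, hx.mono (principal_mono.2 Set.inter_subset_right)⟩
      rwa [hKP] at this
  · filter_upwards [hkg, hgM] with x h1 h2 using h1.trans h2
  · filter_upwards [hkg, hk, hg, hf] with x h1 h2 h3 h4 h5
    by_cases hxF : x ∈ F
    · exact h2 fun hx => h5 ⟨hxF, hx⟩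
    · rw [← norm_le_zero_iff]
      exact h1.trans_eq (by rw [h3 (h4 hxF), norm_zero])

end Exceptional

/-! ### Supports of distributions -/

section Support

open scoped ContDiff

variable {n : ℕ}

/-- A tempered distribution annihilates the test functions supported away from its support. -/
theorem apply_eq_zero_of_dsupport_subset {T : 𝓢'(EuclideanSpace ℝ (Fin n), ℂ)}
    {F : Set (EuclideanSpace ℝ (Fin n))} (hT : Distribution.dsupport T ⊆ F)
    {φ : 𝓢(EuclideanSpace ℝ (Fin n), ℂ)} (hφ : HasCompactSupport φ) (hφF : tsupport φ ⊆ Fᶜ) :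
    T φ = 0 := by
  have hloc : ∀ x ∈ tsupport φ, ∃ s : Set (EuclideanSpace ℝ (Fin n)),
      Distribution.IsVanishingOn T s ∧ IsOpen s ∧ x ∈ s := fun x hx =>
    (Distribution.notMem_dsupport_iff x).1 fun h => hφF hx (hT h)
  choose! U hU hUo hxU using hloc
  obtain ⟨t, ht, htU⟩ := IsCompact.elim_nhds_subcover hφ U fun x hx => (hUo x hx).mem_nhds (hxU x hx)
  obtain ⟨χ, h1, h2, h3, h4, h5⟩ := exists_smooth_partition hφ (fun i : t => U i)
    (fun i => hUo i (ht i i.2)) (fun x hx => by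
      obtain ⟨i, hi, hxi⟩ := Set.mem_iUnion₂.1 (htU hx)
      exact Set.mem_iUnion.2 ⟨⟨i, hi⟩, hxi⟩)
  have hχ : ∀ i, Function.HasTemperateGrowth (χ i) := fun i => (h2 i).hasTemperateGrowth (h1 i)
  have hsum : φ = ∑ i, SchwartzMap.smulLeftCLM ℂ (χ i) φ := by
    ext x
    rw [sum_apply]
    simp only [SchwartzMap.smulLeftCLM_apply_apply (hχ _), smul_eq_mul]
    rw [← Finset.sum_mul]
    by_cases hx : x ∈ tsupport φ
    · rw [h5 x hx, one_mul]
    · rw [image_eq_zero_of_notMem_tsupport hx, mul_zero]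
  rw [hsum, map_sum]
  refine Finset.sum_eq_zero fun i _ => hU i (ht i i.2) _ ?_
  rw [SchwartzMap.smulLeftCLM_apply (hχ i)]
  exact (tsupport_smul_subset_left _ _).trans (h3 i)

theorem dsupport_subset_of_apply_eq_zero {T : 𝓢'(EuclideanSpace ℝ (Fin n), ℂ)}
    {F : Set (EuclideanSpace ℝ (Fin n))} (hF : IsClosed F)
    (h : ∀ φ : 𝓢(EuclideanSpace ℝ (Fin n), ℂ), HasCompactSupport φ → tsupport φ ⊆ Fᶜ → T φ = 0) :
    Distribution.dsupport T ⊆ F := by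
  intro x hx
  by_contra hxF
  obtain ⟨ε, hε, hball⟩ := Metric.isOpen_iff.1 hF.isOpen_compl x hxF
  refine (Distribution.notMem_dsupport_iff x).2 ⟨Metric.ball x ε, fun φ hφ => ?_,
    Metric.isOpen_ball, Metric.mem_ball_self hε⟩ hx
  exact h φ (Metric.isCompact_of_isClosed_isBounded (isClosed_tsupport _)
    (Metric.isBounded_ball.subset hφ)) (hφ.trans hball)

theorem ae_eq_zero_of_apply_eq_zero {f : Lp ℂ 2 (volume : Measure (EuclideanSpace ℝ (Fin n)))}
    {G : Set (EuclideanSpace ℝ (Fin n))} (hG : IsOpen G)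
    (h : ∀ φ : 𝓢(EuclideanSpace ℝ (Fin n), ℂ), HasCompactSupport φ → tsupport φ ⊆ G →
      (f : 𝓢'(EuclideanSpace ℝ (Fin n), ℂ)) φ = 0) : ∀ᵐ x, x ∈ G → f x = 0 := by
  refine hG.ae_eq_zero_of_integral_contDiff_smul_eq_zero
    (((Lp.memLp f).locallyIntegrable (by norm_num)).locallyIntegrableOn _) fun g h1 h2 h3 => ?_
  have hg₁ : HasCompactSupport (Complex.ofRealCLM ∘ g) := h2.comp_left rfl
  have hg₂ : ContDiff ℝ ∞ (Complex.ofRealCLM ∘ g) := by fun_prop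
  have h4 := h (hg₁.toSchwartzMap hg₂) hg₁
    ((tsupport_comp_subset (g := Complex.ofRealCLM) (map_zero _) g).trans h3)
  rw [Lp.toTemperedDistribution_apply] at h4
  simpa using h4

theorem toDistr_ofSchwartz_apply (s : ℝ) (ψ φ : 𝓢(EuclideanSpace ℝ (Fin n), ℂ)) :
    SobolevH.toDistr (SobolevH.ofSchwartz s ψ) φ = ∫ x, φ x * ψ x := by
  have h : SobolevH.toDistr (SobolevH.ofSchwartz s ψ) =
      ((ψ.toLp 2 : Lp ℂ 2 (volume : Measure (EuclideanSpace ℝ (Fin n)))) :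
        𝓢'(EuclideanSpace ℝ (Fin n), ℂ)) := (Lp.toTemperedDistribution_toLp_eq _).symm
  rw [h, Lp.toTemperedDistribution_apply]
  refine integral_congr_ae ?_
  filter_upwards [SchwartzMap.coeFn_toLp ψ 2 volume] with x hx
  rw [hx, smul_eq_mul]

theorem isometry_toL2 (n : ℕ) (s : ℝ) : Isometry (SobolevH.toL2 (n := n) (s := s)) :=
  AddMonoidHomClass.isometry_of_norm _ fun u => (SobolevH.norm_eq u).symm

theorem continuous_toDistr_apply (s : ℝ) (φ : 𝓢(EuclideanSpace ℝ (Fin n), ℂ)) :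
    Continuous fun u : SobolevH n s => SobolevH.toDistr u φ := by
  have h : ∀ u : SobolevH n s, SobolevH.toDistr u φ =
      (SobolevH.toL2 u : 𝓢'(EuclideanSpace ℝ (Fin n), ℂ)) (besselSchwartz (-s) φ) := fun u => by
    rw [← SobolevH.toL2_spec, besselPotential_apply, besselSchwartz_besselSchwartz,
      add_neg_cancel, besselSchwartz_zero]
  simp only [h]
  exact (continuous_toTemperedDistribution_apply _).comp (isometry_toL2 n s).continuous

theorem sobolevTilde_subset_sobolevSupported (s : ℝ) (Ω : Set (EuclideanSpace ℝ (Fin n))) :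
    sobolevTilde s Ω ⊆ sobolevSupported s (closure Ω) := by
  intro u hu
  refine dsupport_subset_of_apply_eq_zero isClosed_closure fun φ _ hφΩ => ?_
  have hcl : IsClosed {u : SobolevH n s | SobolevH.toDistr u φ = 0} :=
    isClosed_eq (continuous_toDistr_apply s φ) continuous_const
  refine closure_minimal ?_ hcl hu
  rintro _ ⟨ψ, _, hψΩ, rfl⟩
  rw [Set.mem_ofPred_eq, toDistr_ofSchwartz_apply]
  refine integral_eq_zero_of_ae (ae_of_all _ fun x => ?_)
  by_cases hx : x ∈ tsupport φ
  · have h1 : x ∉ tsupport ψ := fun h => hφΩ hx (subset_closure (hψΩ h))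
    simp [image_eq_zero_of_notMem_tsupport h1]
  · simp [image_eq_zero_of_notMem_tsupport hx]

theorem toDistr_ofSchwartz (s : ℝ) (φ : 𝓢(EuclideanSpace ℝ (Fin n), ℂ)) :
    SobolevH.toDistr (SobolevH.ofSchwartz s φ) =
      SchwartzMap.toTemperedDistributionCLM (EuclideanSpace ℝ (Fin n)) ℂ volume φ := rfl

/-- The test functions on `Ω`, as a linear subspace of `H^s`. -/
def testSubmodule (s : ℝ) (Ω : Set (EuclideanSpace ℝ (Fin n))) : Submodule ℂ (SobolevH n s) where
  carrier := testFunctions s Ω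
  zero_mem' := by
    refine ⟨0, HasCompactSupport.zero, by simp [tsupport], SobolevH.toDistr_injective ?_⟩
    rw [toDistr_ofSchwartz, map_zero, map_zero]
  add_mem' := by
    rintro _ _ ⟨φ, h1, h2, rfl⟩ ⟨ψ, h3, h4, rfl⟩
    refine ⟨φ + ψ, h1.add h3, (tsupport_add _ _).trans (Set.union_subset h2 h4),
      SobolevH.toDistr_injective ?_⟩
    simp only [toDistr_ofSchwartz, map_add]
  smul_mem' := by
    rintro c _ ⟨φ, h1, h2, rfl⟩
    refine ⟨c • φ, h1.smul_left (f := fun _ => c),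
      (tsupport_smul_subset_right (fun _ => c) _).trans h2, SobolevH.toDistr_injective ?_⟩
    simp only [toDistr_ofSchwartz, map_smul]

/-- `H̃^s(Ω)` is the second annihilator of `𝓓(Ω)`. -/
theorem mem_sobolevTilde_of_integral_eq_zero {s : ℝ} {Ω : Set (EuclideanSpace ℝ (Fin n))}
    {u : SobolevH n s}
    (h : ∀ b : Lp ℂ 2 (volume : Measure (EuclideanSpace ℝ (Fin n))),
      (∀ φ : 𝓢(EuclideanSpace ℝ (Fin n), ℂ), HasCompactSupport φ → tsupport φ ⊆ Ω →
        TemperedDistribution.besselPotential (EuclideanSpace ℝ (Fin n)) ℂ s b φ = 0) →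
      ∫ x, SobolevH.toL2 u x * b x = 0) : u ∈ sobolevTilde s Ω := by
  have hu : SobolevH.toL2 u ∈ ((testSubmodule s Ω).map SobolevH.toL2)ᗮᗮ := by
    intro g hg
    have key : ∀ v : Lp ℂ 2 (volume : Measure (EuclideanSpace ℝ (Fin n))),
        ∫ x, v x * star g x = inner ℂ g v := fun v => by
      rw [integral_mul_eq_inner, star_star]
    rw [← key]
    refine h (star g) fun φ h1 h2 => ?_
    have hmem : SobolevH.ofSchwartz s φ ∈ testFunctions s Ω := ⟨φ, h1, h2, rfl⟩
    have h3 := hg _ (Submodule.mem_map_of_mem (f := SobolevH.toL2) (p := testSubmodule s Ω) hmem)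
    rw [inner_eq_zero_symm, ← key, toL2_ofSchwartz] at h3
    rw [besselPotential_apply, ← integral_mul_toLp, ← h3]
    exact integral_congr_ae (ae_of_all _ fun x => mul_comm _ _)
  rw [Submodule.orthogonal_orthogonal_eq_closure, ← SetLike.mem_coe,
    Submodule.topologicalClosure_coe, Submodule.map_coe] at hu
  rw [sobolevTilde, (isometry_toL2 n s).isUniformInducing.isInducing.closure_eq_preimage_closure_image]
  exact hu

end Support

/-! ### The geometry of continuous boundaries -/

section Geometry

variable {n : ℕ}

theorem CanPush.of_mem_interior {F G : Set (EuclideanSpace ℝ (Fin n))} {x : EuclideanSpace ℝ (Fin n)}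
    (h : x ∈ interior G) : CanPush F G x :=
  ⟨interior G, isOpen_interior.mem_nhds h, 0, 1, one_pos, fun h _ _ y hy => by
    simpa using interior_subset hy.1⟩

/-- A set with continuous boundary can be pushed inside, downwards in the adapted coordinates. -/
theorem IsC0At.canPush {Ω : Set (EuclideanSpace ℝ (Fin n))} {x : EuclideanSpace ℝ (Fin n)}
    (h : IsC0At Ω x) : CanPush (closure Ω) Ω x := by
  obtain ⟨e, a, b, f, hx1, hx2, -, -, hz⟩ := h
  obtain ⟨c, hxc, hcb⟩ := exists_between hx2
  have hV : IsOpen {z | (∀ j, |(e z).fst j| < a j) ∧ |(e z).snd| < c} := by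
    have he : Continuous e := e.continuous
    have h1 : Continuous fun z => (e z).fst :=
      (WithLp.prod_continuous_ofLp 2 _ _).fst.comp he
    have h2 : Continuous fun z => (e z).snd :=
      (WithLp.prod_continuous_ofLp 2 _ _).snd.comp he
    rw [Set.ofPred_and, Set.ofPred_forall]
    refine (isOpen_iInter_of_finite fun j => ?_).inter (isOpen_lt h2.abs continuous_const)
    exact isOpen_lt (((EuclideanSpace.proj j).continuous.comp h1).abs) continuous_const
  refine ⟨_, hV.mem_nhds ⟨hx1, hxc⟩, e.linearIsometryEquiv.symm (WithLp.toLp 2 (0, -1)), b - c,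
    by linarith, ?_⟩
  rintro h h0 hbc y ⟨⟨hy1, hy2⟩, hy3⟩
  have hle : (e y).snd ≤ f (e y).fst := by
    have h1 := hz y hy1 (hy2.trans hcb)
    rw [closure_eq_self_union_frontier] at hy3
    rcases hy3 with hy3 | hy3
    · exact (h1.1.1 hy3).le
    · exact (h1.2.1 hy3).le
  have hev : e (y + h • e.linearIsometryEquiv.symm (WithLp.toLp 2 (0, -1))) =
      h • WithLp.toLp 2 (0, -1) + e y := by
    rw [add_comm, ← vadd_eq_add, e.map_vadd, map_smul, LinearIsometryEquiv.apply_symm_apply,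
      vadd_eq_add]
  have hfst : (e (y + h • e.linearIsometryEquiv.symm (WithLp.toLp 2 (0, -1)))).fst = (e y).fst := by
    rw [hev]
    simp
  have hsnd : (e (y + h • e.linearIsometryEquiv.symm (WithLp.toLp 2 (0, -1)))).snd =
      (e y).snd - h := by
    rw [hev]
    simp
    ring
  refine (hz _ (by rwa [hfst]) ?_).1.2 ?_
  · rw [abs_lt] at hy2
    rw [hsnd, abs_lt]
    constructor <;> linarith [hy2.1, hy2.2]
  · rw [hfst, hsnd]
    linarith

/-- If `Ω` can be pushed inside, then its complement can be pushed outside, in the opposite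
direction. -/
theorem CanPush.compl {Ω : Set (EuclideanSpace ℝ (Fin n))} {x : EuclideanSpace ℝ (Fin n)}
    (h : CanPush (closure Ω) Ω x) : CanPush Ωᶜ (closure Ω)ᶜ x := by
  obtain ⟨V, hV, v, r, hr, hp⟩ := h
  have hc : Tendsto (fun q : EuclideanSpace ℝ (Fin n) × ℝ => q.1 - q.2 • v) (𝓝 x ×ˢ 𝓝 0)
      (𝓝 x) := by
    have : Continuous fun q : EuclideanSpace ℝ (Fin n) × ℝ => q.1 - q.2 • v := by fun_prop
    simpa [nhds_prod_eq] using this.tendsto (x, 0)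
  obtain ⟨W, hW, I, hI, hWI⟩ := mem_prod_iff.1 (hc hV)
  obtain ⟨ε, hε, hball⟩ := Metric.mem_nhds_iff.1 hI
  refine ⟨W, hW, -v, min r ε, lt_min hr hε, ?_⟩
  rintro h h0 hh y ⟨hyW, hy⟩ hcl
  have hmem : y - h • v ∈ V := hWI (Set.mk_mem_prod hyW (hball (by
    rw [mem_ball_zero_iff, Real.norm_of_nonneg h0.le]
    exact hh.trans_le (min_le_right _ _))))
  rw [smul_neg, ← sub_eq_add_neg] at hcl
  have h1 := hp h h0 (hh.trans_le (min_le_left _ _)) _ ⟨hmem, hcl⟩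
  exact hy (by simpa using h1)

/-- Being able to push a set inside is a local property. -/
theorem CanPush.of_inter_subset {Ω W U : Set (EuclideanSpace ℝ (Fin n))}
    {x : EuclideanSpace ℝ (Fin n)} (h : CanPush (closure W) W x) (hU : U ∈ 𝓝 x)
    (hUW : Ω ∩ U ⊆ W) (hW : W ⊆ Ω) : CanPush (closure Ω) Ω x := by
  obtain ⟨V, hV, v, r, hr, hp⟩ := h
  refine ⟨V ∩ interior U, inter_mem hV (interior_mem_nhds.2 hU), v, r, hr, ?_⟩
  rintro h h0 hh y ⟨⟨hyV, hyU⟩, hy⟩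
  refine hW (hp h h0 hh y ⟨hyV, ?_⟩)
  have h1 := isOpen_interior.inter_closure ⟨hyU, hy⟩
  refine closure_mono (fun z hz => hUW ⟨hz.2, interior_subset hz.1⟩) h1

/-- Near a boundary point outside of `P`, a locally finite union of sets whose closures meet only in
`P` coincides with one of these sets. -/
theorem canPush_sUnion {𝒰 : Set (Set (EuclideanSpace ℝ (Fin n)))}
    {P : Set (EuclideanSpace ℝ (Fin n))} (h𝒰 : ∀ W ∈ 𝒰, IsOpen W ∧ IsC0 W)
    (hP : ∀ W₁ ∈ 𝒰, ∀ W₂ ∈ 𝒰, W₁ ≠ W₂ → closure W₁ ∩ closure W₂ ⊆ P)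
    {x : EuclideanSpace ℝ (Fin n)} (hx : x ∈ frontier (⋃₀ 𝒰) \ P)
    (hfin : ∃ U ∈ 𝓝 x, {W ∈ 𝒰 | (W ∩ U).Nonempty}.Finite) :
    CanPush (closure (⋃₀ 𝒰)) (⋃₀ 𝒰) x := by
  obtain ⟨U, hU, hfin⟩ := hfin
  have hcl : x ∈ closure (⋃₀ {W ∈ 𝒰 | (W ∩ U).Nonempty}) := by
    have h1 := isOpen_interior.inter_closure
      ⟨mem_interior_iff_mem_nhds.2 hU, frontier_subset_closure hx.1⟩
    refine closure_mono ?_ h1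
    rintro z ⟨hz1, W, hW, hz2⟩
    exact ⟨W, ⟨hW, z, hz2, interior_subset hz1⟩, hz2⟩
  rw [hfin.closure_sUnion, Set.mem_iUnion₂] at hcl
  obtain ⟨W, ⟨hW, hWU⟩, hxW⟩ := hcl
  have hxfr : x ∈ frontier W := by
    rw [(h𝒰 W hW).1.frontier_eq]
    refine ⟨hxW, fun h => ?_⟩
    have h1 := hx.1
    rw [(isOpen_sUnion fun W hW => (h𝒰 W hW).1).frontier_eq] at h1
    exact h1.2 ⟨W, hW, h⟩
  have hN : U ∩ ⋂ W' ∈ {W ∈ 𝒰 | (W ∩ U).Nonempty} \ {W}, (closure W')ᶜ ∈ 𝓝 x := by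
    refine inter_mem hU ((biInter_mem (hfin.subset Set.sdiff_subset)).2 fun W' hW' => ?_)
    refine isClosed_closure.isOpen_compl.mem_nhds fun h => hx.2 ?_
    exact hP W hW W' hW'.1.1 (fun he => hW'.2 he.symm) ⟨hxW, h⟩
  refine ((h𝒰 W hW).2 x hxfr).canPush.of_inter_subset hN ?_ (Set.subset_sUnion_of_mem hW)
  rintro z ⟨⟨W', hW', hz⟩, hzU, hz2⟩
  by_contra hzW
  refine Set.mem_iInter₂.1 hz2 W' ⟨⟨hW', z, hz, hzU⟩, ?_⟩ (subset_closure hz)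
  rintro rfl
  exact hzW hz

end Geometry

/-! ### The equality of the two spaces -/

/-- Since `P` is closed, its limit points lie in `P ⊆ ∂Ω`. -/
theorem IsExceptionalSet.finite_inter_derivedSet {n : ℕ} {Ω P K : Set (EuclideanSpace ℝ (Fin n))}
    (hP : IsExceptionalSet Ω P) (hK : IsCompact K) : (K ∩ derivedSet P).Finite := by
  have hsub : derivedSet P ⊆ frontier Ω :=
    (isClosed_iff_derivedSet_subset P |>.1 hP.isClosed).trans hP.subset_frontier
  refine (hP.finite_limit_points (K ∩ frontier Ω) Set.inter_subset_right
    (hK.isBounded.subset Set.inter_subset_left)).subset ?_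
  exact fun x hx => ⟨⟨hx.1, hsub hx.2⟩, hx.2⟩

/-- The distributions `J_s b` with `b ∈ L²` are the elements of `H^{-s}`. -/
theorem exists_sobolevH_neg_eq_besselPotential {n : ℕ} (s : ℝ)
    (b : Lp ℂ 2 (volume : Measure (EuclideanSpace ℝ (Fin n)))) :
    ∃ v : SobolevH n (-s), SobolevH.toDistr v =
      TemperedDistribution.besselPotential (EuclideanSpace ℝ (Fin n)) ℂ s b ∧
      SobolevH.toL2 v = b := by
  have h : TemperedDistribution.besselPotential (EuclideanSpace ℝ (Fin n)) ℂ (-s)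
      (TemperedDistribution.besselPotential (EuclideanSpace ℝ (Fin n)) ℂ s b) = b := by simp
  exact ⟨⟨_, b, h⟩, rfl, SobolevH.eq_of_coe_eq ((SobolevH.toL2_spec _).symm.trans h)⟩

/-- The equality of the two spaces, with the continuity of the boundary replaced by the property that
is used: near the boundary points outside of `P`, small translations push `closure Ω` into `Ω`. -/
theorem sobolevTilde_eq_of_canPush {n : ℕ} {s : ℝ}
    (hns : (2 ≤ n ∧ |s| ≤ 1) ∨ (n = 1 ∧ |s| ≤ 1 / 2)) {Ω P : Set (EuclideanSpace ℝ (Fin n))}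
    (hΩ : IsOpen Ω) (hP : IsExceptionalSet Ω P)
    (hpush : ∀ x ∈ frontier Ω \ P, CanPush (closure Ω) Ω x) :
    sobolevTilde s Ω = sobolevSupported s (closure Ω) := by
  refine (sobolevTilde_subset_sobolevSupported s Ω).antisymm fun u hu => ?_
  refine mem_sobolevTilde_of_integral_eq_zero fun b hb => ?_
  rcases le_total 0 s with hs | hs
  · rw [abs_of_nonneg hs] at hns
    obtain ⟨f, hf, -⟩ := SobolevH.exists_lp_eq_toDistr hs u
    refine OrthogonalTo.of_exceptional hs hns (F := closure Ω) isClosed_closure hΩ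
      (fun K hK _ => hP.finite_inter_derivedSet hK) (fun x hx => ?_) hb
      (ae_eq_zero_of_apply_eq_zero isClosed_closure.isOpen_compl fun φ h1 h2 => ?_) u hf
    · by_cases hxΩ : x ∈ Ω
      · exact CanPush.of_mem_interior (by rwa [hΩ.interior_eq])
      · exact hpush x ⟨by rw [hΩ.frontier_eq]; exact ⟨hx.1, hxΩ⟩, hx.2⟩
    · rw [← hf]
      exact apply_eq_zero_of_dsupport_subset hu h1 h2
  · -- The pairing of `H^s` with `H^{-s}` is symmetric, so the roles of `u` and `J_s b` are exchanged.
    rw [abs_of_nonpos hs] at hns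
    have hs' : 0 ≤ -s := by linarith
    obtain ⟨v, hv, hvb⟩ := exists_sobolevH_neg_eq_besselPotential s b
    obtain ⟨f, hf, -⟩ := SobolevH.exists_lp_eq_toDistr hs' v
    have key : OrthogonalTo (-s) (SobolevH.toL2 u) f := by
      refine OrthogonalTo.of_exceptional hs' hns (G := (closure Ω)ᶜ) hΩ.isClosed_compl isClosed_closure.isOpen_compl
        (fun K hK _ => hP.finite_inter_derivedSet hK) (fun x hx => ?_) (fun φ h1 h2 => ?_) ?_
      · by_cases hxΩ : x ∈ closure Ω
        · exact (hpush x ⟨by rw [hΩ.frontier_eq]; exact ⟨hxΩ, hx.1⟩, hx.2⟩).compl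
        · exact CanPush.of_mem_interior (by rwa [isClosed_closure.isOpen_compl.interior_eq])
      · rw [← SobolevH.toL2_spec]
        simpa using apply_eq_zero_of_dsupport_subset hu h1 h2
      · have h := ae_eq_zero_of_apply_eq_zero (f := f) hΩ fun φ h1 h2 => by
          rw [← hf, hv]
          exact hb φ h1 h2
        filter_upwards [h] with x hx hx2
        exact hx (not_not.1 hx2)
    rw [← key v hf, hvb]
    exact integral_congr_ae (ae_of_all _ fun x => mul_comm _ _)

theorem theorem3p23 (n : ℕ) (s : ℝ)
    (hns : (2 ≤ n ∧ |s| ≤ 1) ∨ (n = 1 ∧ |s| ≤ 1 / 2)) :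
    (∀ Ω P : Set (EuclideanSpace ℝ (Fin n)), IsOpen Ω → IsExceptionalSet Ω P →
      IsC0Except Ω P →
      sobolevTilde s Ω = sobolevSupported s (closure Ω)) ∧
    (∀ (𝒰 : Set (Set (EuclideanSpace ℝ (Fin n)))) (P : Set (EuclideanSpace ℝ (Fin n))),
      (∀ W ∈ 𝒰, IsOpen W ∧ IsC0 W) →
      𝒰.PairwiseDisjoint id →
      IsExceptionalSet (⋃₀ 𝒰) P →
      (∀ W₁ ∈ 𝒰, ∀ W₂ ∈ 𝒰, W₁ ≠ W₂ → closure W₁ ∩ closure W₂ ⊆ P) →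
      (∀ x ∈ frontier (⋃₀ 𝒰) \ P, ∃ U ∈ 𝓝 x, {W ∈ 𝒰 | (W ∩ U).Nonempty}.Finite) →
      sobolevTilde s (⋃₀ 𝒰) = sobolevSupported s (closure (⋃₀ 𝒰))) := by
  refine ⟨fun Ω P hΩ hP hC => sobolevTilde_eq_of_canPush hns hΩ hP fun x hx => (hC x hx).canPush,
    fun 𝒰 P h𝒰 _ hP hcl hfin => ?_⟩
  exact sobolevTilde_eq_of_canPush hns (isOpen_sUnion fun W hW => (h𝒰 W hW).1) hP fun x hx =>
    canPush_sUnion h𝒰 hcl hx (hfin x hx)
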